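/- Let $k$ be a field (of arbitrary characteristic) and let $H$ be a Hopf algebra over $k$ with multiplication $m$, unit $1$, comultiplication $\Delta$, counit $\varepsilon$ and antipode $S$. Assume that $H$ is finite-dimensional over $k$; then $S$ is bijective. Put $m_1=\Delta_1=I$ (the identity map of $H$), $m_n=m\circ(m_{n-1}\otimes I):H^{\otimes n}\to H$ and $\Delta_n=(\Delta_{n-1}\otimes I)\circ\Delta:H\to H^{\otimes n}$ for $n\ge 2$. The exponent $\exp(H)$ is the smallest positive integer $n$ such that $$m_n\circ\bigl(I\otimes S^{-2}\otimes\cdots\otimes S^{-2n+2}\bigr)\circ\Delta_n=\varepsilon\cdot 1,$$ and $\exp(H)=\infty$ if there is no such $n$. Let $D(H)$ be the Drinfeld double of $H$: the Hopf algebra whose underlying coalgebra is the tensor product coalgebra $H^{*\mathrm{cop}}\otimes H$, with unit $\varepsilon\otimes 1$ and multiplication $$(p\otimes h)(q\otimes g)=\sum p\cdot q\bigl(S^{-1}(h_{(3)})\,?\,h_{(1)}\bigr)\otimes h_{(2)}\,g ,\qquad p,q\in H^*,\ h,g\in H,$$ where $q(a\,?\,b)$ denotes the functional $x\mapsto q(axb)$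 and $\cdot$ is the convolution product of $H^*$. Then $$\exp(D(H))=\exp(H),$$ as an equality in $\{1,2,3,\dots\}\cup\{\infty\}$. -/

import Mathlib

set_option linter.unusedSectionVars false
set_option linter.unusedSimpArgs false

namespace HopfExponent
open scoped TensorProduct
open Coalgebra HopfAlgebra

section LarsonSweedler
variable {k H : Type*} [Field k] [Ring H] [HopfAlgebra k H]

/-- Contraction of the second tensor factor against a functional. -/
noncomputable def contr (f : Module.Dual k H) : H ⊗[k] H →ₗ[k] H :=
  (TensorProduct.rid k H).toLinearMap ∘ₗ f.lTensor H

@[simp] lemma contr_tmul (f : Module.Dual k H) (a b : H) :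
    contr f (a ⊗ₜ[k] b) = f b • a := by simp [contr]

lemma sum_coassoc {X : Type*} [AddCommGroup X] [Module k X] (F : H ⊗[k] (H ⊗[k] H) →ₗ[k] X)
    (h : H) :
    ∑ i ∈ (ℛ k h).index, ∑ j ∈ (ℛ k ((ℛ k h).left i)).index,
      F ((ℛ k ((ℛ k h).left i)).left j ⊗ₜ ((ℛ k ((ℛ k h).left i)).right j ⊗ₜ (ℛ k h).right i)) =
    ∑ i ∈ (ℛ k h).index, ∑ j ∈ (ℛ k ((ℛ k h).right i)).index,
      F ((ℛ k h).left i ⊗ₜ ((ℛ k ((ℛ k h).right i)).left j ⊗ₜ (ℛ k ((ℛ k h).right i)).right j)) := by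
  simpa using congr(F $(sum_tmul_tmul_eq (ℛ k h) (fun i => ℛ k ((ℛ k h).left i))
    (fun i => ℛ k ((ℛ k h).right i))))

lemma sum_counit_smul_left (h : H) :
    ∑ i ∈ (ℛ k h).index, counit (R := k) ((ℛ k h).right i) • (ℛ k h).left i = h := by
  simpa [-sum_tmul_counit_eq] using congr(TensorProduct.rid k H $(sum_tmul_counit_eq (R := k) (ℛ k h)))

lemma sum_antipode_antipode (h : H) (r : H) :
    ∑ i ∈ (ℛ k h).index, antipode k (r * antipode k ((ℛ k h).left i) * (ℛ k h).right i) =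
      counit (R := k) h • antipode k r := by
  simp_rw [mul_assoc]
  rw [← map_sum, ← Finset.mul_sum, sum_antipode_mul_eq_smul]; simp

/-- The map `y ↦ y₁ ⊗ S²(y₂)`. -/
noncomputable def sq : H →ₗ[k] H ⊗[k] H :=
  (antipode k ∘ₗ antipode k).lTensor H ∘ₗ comul

lemma mul_contr_sq (f : Module.Dual k H) (h y : H) :
    h * contr f (sq y) = ∑ i ∈ (ℛ k h).index,
      contr (f ∘ₗ LinearMap.mulLeft k (antipode k ((ℛ k h).right i)))
        (sq ((ℛ k h).left i * y)) := by
  have key : ∀ t : H ⊗[k] H, h * contr f ((antipode k ∘ₗ antipode k).lTensor H t) =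
      ∑ i ∈ (ℛ k h).index,
      contr (f ∘ₗ LinearMap.mulLeft k (antipode k ((ℛ k h).right i)))
        ((antipode k ∘ₗ antipode k).lTensor H (comul ((ℛ k h).left i) * t)) := by
    intro t
    induction t with
    | zero => simp
    | add s t hs ht => simp only [map_add, mul_add, hs, ht, Finset.sum_add_distrib]
    | tmul a b =>
      let F : H ⊗[k] (H ⊗[k] H) →ₗ[k] H :=
        contr (f ∘ₗ antipode k ∘ₗ LinearMap.mulLeft k (antipode k b)) ∘ₗ
          TensorProduct.map (LinearMap.mulRight k a)
            (LinearMap.mul' k H ∘ₗ (antipode k).rTensor H)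
      have h1 := sum_coassoc F h
      simp only [F] at h1
      have e : ∀ i, (comul ((ℛ k h).left i) : H ⊗[k] H) = _ := fun i => (ℛ k ((ℛ k h).left i)).eq.symm
      simp_rw [e]
      simp [Finset.sum_mul, antipode_mul_antidistrib] at h1 ⊢
      simp [mul_assoc] at h1 ⊢
      rw [h1]
      simp_rw [← Finset.sum_smul, ← map_sum f, ← antipode_mul_antidistrib,
        antipode_mul_antidistrib (_ : H) b, sum_antipode_antipode]
      simp_rw [map_smul, smul_assoc, smul_comm (counit (R := k) _), ← Finset.smul_sum,
        ← smul_mul_assoc, ← Finset.sum_mul, sum_counit_smul_left, smul_mul_assoc]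
  have := key (comul y)
  simpa [sq] using this


variable [FiniteDimensional k H]

lemma sum_dual_comp {X ι : Type*} [AddCommGroup X] [Module k X] [Fintype ι] (e : Module.Basis ι k H)
    (φ : H →ₗ[k] H) (Ψ : H →ₗ[k] Module.Dual k H →ₗ[k] X) :
    ∑ i, Ψ (φ (e i)) (e.coord i) = ∑ i, Ψ (e i) (e.coord i ∘ₗ φ) := by
  have h1 : ∀ i, φ (e i) = ∑ j, e.coord j (φ (e i)) • e j := fun i => (e.sum_repr _).symm
  have h2 : ∀ j, e.coord j ∘ₗ φ = ∑ i, e.coord j (φ (e i)) • e.coord i := fun j => by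
    refine e.ext fun i => ?_
    classical
    simp [Finsupp.single_apply]
  simp_rw [h2]
  conv_lhs => enter [2, i]; rw [h1 i]
  simp only [map_sum, map_smul, LinearMap.sum_apply, LinearMap.smul_apply]
  exact Finset.sum_comm

/-- Every `P x` is a left integral. -/
noncomputable def P (x : H) : H :=
  ∑ i, contr ((Module.finBasis k H).coord i) (sq (Module.finBasis k H i * x))


lemma contr_add (f g : Module.Dual k H) (t : H ⊗[k] H) :
    contr (f + g) t = contr f t + contr g t := by simp [contr, LinearMap.lTensor_add]

lemma contr_smul (c : k) (f : Module.Dual k H) (t : H ⊗[k] H) :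
    contr (c • f) t = c • contr f t := by simp [contr, LinearMap.lTensor_smul]

/-- An auxiliary bilinear map. -/
noncomputable def bil (φ : H →ₗ[k] H ⊗[k] H) (ψ : H →ₗ[k] H) :
    H →ₗ[k] Module.Dual k H →ₗ[k] H :=
  LinearMap.mk₂ k (fun y f => contr (f ∘ₗ ψ) (φ y))
    (fun f g t => by simp) (fun c f t => by simp)
    (fun f s t => by simp [LinearMap.add_comp, contr_add])
    (fun c f t => by simp [LinearMap.smul_comp, contr_smul])

lemma mul_P (h x : H) : h * P (k := k) x = counit (R := k) h • P (k := k) x := by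
  set e := Module.finBasis k H with he
  simp only [P, Finset.mul_sum, mul_contr_sq, ← he]
  rw [Finset.sum_comm]
  have := fun i => sum_dual_comp e (LinearMap.mulLeft k ((ℛ k h).left i))
    (bil (sq ∘ₗ LinearMap.mulRight k x) (LinearMap.mulLeft k (antipode k ((ℛ k h).right i))))
  simp only [bil, LinearMap.mk₂_apply, LinearMap.comp_apply, LinearMap.mulLeft_apply,
    LinearMap.mulRight_apply, mul_assoc] at this
  simp only [this]
  rw [Finset.sum_comm, Finset.smul_sum]
  refine Finset.sum_congr rfl fun j _ => ?_
  have h3 : ∀ (f : Module.Dual k H) (t : H ⊗[k] H), ∑ i ∈ (ℛ k h).index,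
      contr ((f ∘ₗ LinearMap.mulLeft k ((ℛ k h).left i)) ∘ₗ
        LinearMap.mulLeft k (antipode k ((ℛ k h).right i))) t =
      counit (R := k) h • contr f t := by
    intro f t
    induction t with
    | zero => simp
    | add s t hs ht => simp only [map_add, hs, ht, Finset.sum_add_distrib, smul_add]
    | tmul a b =>
      simp only [contr_tmul, LinearMap.comp_apply, LinearMap.mulLeft_apply, ← mul_assoc,
        ← Finset.sum_smul, ← map_sum, ← Finset.sum_mul, sum_mul_antipode_eq_smul]
      simp [smul_smul]
  exact h3 _ _

lemma sum_P (x : H) : ∑ j, contr ((Module.finBasis k H).coord j)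
    ((antipode k).lTensor H (comul (P (k := k) (Module.finBasis k H j * x)))) = x := by
  set e := Module.finBasis k H with he
  have h1 : ∀ y : H, (antipode k).lTensor H (comul y) =
      ∑ i ∈ (ℛ k y).index, (ℛ k y).left i ⊗ₜ antipode k ((ℛ k y).right i) := by
    intro y; conv_lhs => rw [← (ℛ k y).eq]
    simp
  have h2 : ∀ (g f : Module.Dual k H) (y : H), contr g ((antipode k).lTensor H
      (comul (contr f (sq y)))) = 
      ∑ i ∈ (ℛ k y).index, ∑ j ∈ (ℛ k ((ℛ k y).right i)).index,
        (f (antipode k (antipode k ((ℛ k ((ℛ k y).right i)).right j))) *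
        g (antipode k ((ℛ k ((ℛ k y).right i)).left j))) • (ℛ k y).left i := by
    intro g f y
    let F : H ⊗[k] (H ⊗[k] H) →ₗ[k] H :=
      TensorProduct.rid k H ∘ₗ TensorProduct.map LinearMap.id
        (LinearMap.mul' k k ∘ₗ TensorProduct.comm k k k ∘ₗ
          TensorProduct.map (g ∘ₗ antipode k) (f ∘ₗ antipode k ∘ₗ antipode k))
    have h3 := sum_coassoc F y
    simp [F] at h3
    rw [← h3]
    have : sq (k := k) y = ∑ i ∈ (ℛ k y).index, (ℛ k y).left i ⊗ₜ
        antipode k (antipode k ((ℛ k y).right i)) := by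
      rw [sq, LinearMap.comp_apply]; conv_lhs => rw [← (ℛ k y).eq]
      simp
    rw [this]
    simp [h1, Finset.smul_sum, smul_smul]
  have h4 : ∀ y : H, ∀ i, ∑ j, contr (e.coord j) ((antipode k).lTensor H
      (comul (contr (e.coord i ∘ₗ LinearMap.mulRight k (e j * x)) (sq y)))) = e.coord i x • y := by
    intro y i
    simp only [h2]
    rw [Finset.sum_comm]
    have h5 : ∀ a b : H, ∑ j, e.coord i (a * (e j * x)) * e.coord j b = e.coord i (a * b * x) := by
      intro a b
      have h := congr(e.coord i (a * ($(e.sum_repr b) * x)))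
      simp only [Finset.sum_mul, Finset.mul_sum, map_sum, smul_mul_assoc, mul_smul_comm, map_smul,
        smul_eq_mul] at h
      rw [mul_assoc a b x, ← h]
      exact Finset.sum_congr rfl fun j _ => mul_comm _ _
    simp only [LinearMap.comp_apply, LinearMap.mulRight_apply]
    simp_rw [Finset.sum_comm (s := Finset.univ), ← Finset.sum_smul, h5,
      ← antipode_mul_antidistrib, ← map_sum, ← Finset.sum_mul, ← map_sum, sum_mul_antipode_eq_smul]
    simp only [map_smul, antipode_one, smul_mul_assoc, one_mul, smul_assoc]
    simp_rw [smul_comm _ (e.coord i x), ← Finset.smul_sum, sum_counit_smul_left]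
  have h6 := fun j => sum_dual_comp e (LinearMap.mulRight k (e j * x)) (bil sq LinearMap.id)
  simp only [bil, LinearMap.mk₂_apply, LinearMap.comp_id, LinearMap.mulRight_apply] at h6
  simp only [P, ← he, h6, map_sum]
  rw [Finset.sum_comm]
  simp only [h4]
  exact e.sum_repr x

lemma exists_integral : ∃ Λ : H, Λ ≠ 0 ∧ ∀ h : H, h * Λ = counit (R := k) h • Λ := by
  by_contra! hc
  have h0 : ∀ x : H, P (k := k) x = 0 := by
    intro x
    by_contra hx
    obtain ⟨h, hh⟩ := hc _ hx
    exact hh (mul_P h x)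
  have := sum_P (k := k) (1 : H)
  have : Nontrivial H := Bialgebra.nontrivial k
  simp_all

lemma integral_comm {Λ : H} (hΛ : ∀ h : H, h * Λ = counit (R := k) h • Λ) (f : Module.Dual k H)
    (h : H) :
    h * contr f ((antipode k).lTensor H (comul Λ)) =
      contr (f ∘ₗ LinearMap.mulRight k h) ((antipode k).lTensor H (comul Λ)) := by
  have key : ∀ t : H ⊗[k] H, h * contr f ((antipode k).lTensor H t) =
      ∑ i ∈ (ℛ k h).index,
      contr (f ∘ₗ LinearMap.mulRight k ((ℛ k h).right i))
        ((antipode k).lTensor H (comul ((ℛ k h).left i) * t)) := by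
    intro t
    induction t with
    | zero => simp
    | add s t hs ht => simp only [map_add, mul_add, hs, ht, Finset.sum_add_distrib]
    | tmul a b =>
      let F : H ⊗[k] (H ⊗[k] H) →ₗ[k] H :=
        contr (f ∘ₗ LinearMap.mulLeft k (antipode k b)) ∘ₗ
          TensorProduct.map (LinearMap.mulRight k a)
            (LinearMap.mul' k H ∘ₗ (antipode k).rTensor H)
      have h1 := sum_coassoc F h
      simp only [F] at h1
      have e : ∀ i, (comul ((ℛ k h).left i) : H ⊗[k] H) = _ := fun i => (ℛ k ((ℛ k h).left i)).eq.symm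
      simp_rw [e]
      simp [Finset.sum_mul, antipode_mul_antidistrib] at h1 ⊢
      simp [mul_assoc] at h1 ⊢
      rw [h1]
      simp_rw [← Finset.sum_smul, ← map_sum f, ← Finset.mul_sum, sum_antipode_mul_eq_smul]
      simp_rw [mul_smul_comm, mul_one, map_smul, smul_assoc, smul_comm (counit (R := k) _),
        ← Finset.smul_sum,
        ← smul_mul_assoc, ← Finset.sum_mul, sum_counit_smul_left, smul_mul_assoc]
  rw [key]
  simp_rw [← Bialgebra.comul_mul, hΛ, map_smul]
  conv_rhs => rw [← sum_counit_smul (R := k) (ℛ k h)]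
  have : ∀ t : H ⊗[k] H, contr (f ∘ₗ LinearMap.mulRight k (∑ i ∈ (ℛ k h).index,
      counit (R := k) ((ℛ k h).left i) • (ℛ k h).right i)) t = ∑ i ∈ (ℛ k h).index,
      counit (R := k) ((ℛ k h).left i) • contr (f ∘ₗ LinearMap.mulRight k ((ℛ k h).right i)) t := by
    intro t
    induction t with
    | zero => simp
    | add s t hs ht => simp only [map_add, hs, ht, Finset.sum_add_distrib, smul_add]
    | tmul a b =>
      simp [Finset.mul_sum, Finset.sum_smul, smul_smul]
  exact (this _).symm

lemma antipode_surjective : Function.Surjective (antipode k : H →ₗ[k] H) := by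
  obtain ⟨Λ, hΛ0, hΛ⟩ := exists_integral (k := k) (H := H)
  rw [← LinearMap.range_eq_top]
  by_contra hne
  obtain ⟨f, hf0, hf⟩ := Submodule.exists_le_ker_of_lt_top _ (lt_top_iff_ne_top.mpr hne)
  have hf' : ∀ x, f (antipode k x) = 0 := fun x => hf ⟨x, rfl⟩
  apply hf0
  ext h
  set e := Module.finBasis k H with he
  have h1 : ∀ c : H, ∑ i ∈ (ℛ k Λ).index, f (antipode k ((ℛ k Λ).right i) * c) • (ℛ k Λ).left i
      = 0 := by
    intro c
    have h2 := integral_comm hΛ f c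
    rw [← (ℛ k Λ).eq] at h2
    simpa [hf'] using h2.symm
  have h3 : ∑ i ∈ (ℛ k Λ).index, ∑ j ∈ (ℛ k ((ℛ k Λ).left i)).index,
      f (antipode k ((ℛ k Λ).right i) *
        (antipode k (antipode k ((ℛ k ((ℛ k Λ).left i)).right j)) * h)) •
        (ℛ k ((ℛ k Λ).left i)).left j = 0 := by
    have h4 := fun l => congr(contr (e.coord l ∘ₗ LinearMap.mulRight k h ∘ₗ antipode k ∘ₗ antipode k)
      (comul $(h1 (e l))))
    have h5 : ∀ i, (comul ((ℛ k Λ).left i) : H ⊗[k] H) = _ :=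
      fun i => (ℛ k ((ℛ k Λ).left i)).eq.symm
    simp only [map_sum, map_smul, map_zero] at h4
    have h6 := Finset.sum_congr (rfl : (Finset.univ : Finset (Fin (Module.finrank k H))) = _)
      fun l _ => h4 l
    rw [Finset.sum_comm, Finset.sum_const_zero] at h6
    rw [← h6]
    refine Finset.sum_congr rfl fun i _ => ?_
    rw [h5]
    simp only [map_sum, contr_tmul, Finset.smul_sum, smul_smul]
    rw [Finset.sum_comm]
    refine Finset.sum_congr rfl fun j _ => ?_
    rw [← Finset.sum_smul]
    congr 1
    have h7 := congr(f (antipode k ((ℛ k Λ).right i) * $(e.sum_repr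
      (antipode k (antipode k ((ℛ k ((ℛ k Λ).left i)).right j)) * h))))
    simp only [Finset.mul_sum, map_sum, mul_smul_comm, map_smul, smul_eq_mul] at h7
    simp only [LinearMap.comp_apply, LinearMap.mulRight_apply]
    rw [← h7]
    exact Finset.sum_congr rfl fun l _ => mul_comm _ _
  let F : H ⊗[k] (H ⊗[k] H) →ₗ[k] H :=
    contr (f ∘ₗ LinearMap.mulRight k h ∘ₗ antipode k) ∘ₗ
          LinearMap.lTensor H (LinearMap.mul' k H ∘ₗ (antipode k).rTensor H)
  have h8 := sum_coassoc F Λ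
  simp only [F, LinearMap.comp_apply, LinearMap.lTensor_tmul, contr_tmul, LinearMap.rTensor_tmul,
    LinearMap.mul'_apply, LinearMap.mulRight_apply, antipode_mul_antidistrib, mul_assoc] at h8
  rw [h3] at h8
  simp_rw [← mul_assoc, ← antipode_mul_antidistrib, ← Finset.sum_smul, ← map_sum f,
    ← Finset.sum_mul, ← map_sum, sum_antipode_mul_eq_smul] at h8
  simp only [map_smul, antipode_one, smul_mul_assoc, one_mul, smul_assoc] at h8
  simp_rw [smul_comm _ (f h), ← Finset.smul_sum, sum_counit_smul_left] at h8
  simpa [hΛ0] using h8.symm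

theorem antipode_bijective : Function.Bijective (antipode k : H →ₗ[k] H) :=
  ⟨LinearMap.injective_iff_surjective.mpr antipode_surjective, antipode_surjective⟩

end LarsonSweedler

section Twist
open WithConv
variable {k C D X Y B : Type*} [CommRing k] [AddCommGroup C] [Module k C] [Coalgebra k C]
  [AddCommGroup D] [Module k D] [Coalgebra k D] [Ring X] [Algebra k X] [Ring Y] [Algebra k Y]
  [Ring B] [Bialgebra k B]

/-- A scalar-valued map, viewed in the convolution algebra of `X`-valued maps. -/
noncomputable def scal (X : Type*) [Ring X] [Algebra k X] (s : C →ₗ[k] k) :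
    WithConv (C →ₗ[k] X) := toConv (Algebra.linearMap k X ∘ₗ s)

lemma scal_mul (s t : WithConv (C →ₗ[k] k)) :
    scal X s.ofConv * scal X t.ofConv = scal X (s * t).ofConv := by
  have := LinearMap.algHom_comp_convMul_distrib (Algebra.ofId k X) s t
  exact congr(toConv $this.symm)

lemma scal_one : scal X (1 : WithConv (C →ₗ[k] k)).ofConv = 1 := rfl

lemma scal_mul_eq_one {s t : C →ₗ[k] k} (h : toConv s * toConv t = 1) :
    scal X s * scal X t = 1 := by
  rw [← scal_one, ← h, ← scal_mul]

lemma algHom_scal (h : X →ₐ[k] Y) (s : C →ₗ[k] k) :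
    toConv (h.toLinearMap ∘ₗ (scal X s).ofConv) = scal Y s := by
  ext; simp [scal]

lemma map_comp_comul (f g : C →ₗ[k] B) :
    toConv (TensorProduct.map f g ∘ₗ comul) =
      toConv ((Algebra.TensorProduct.includeLeft : B →ₐ[k] B ⊗[k] B).toLinearMap ∘ₗ f) *
      toConv ((Algebra.TensorProduct.includeRight : B →ₐ[k] B ⊗[k] B).toLinearMap ∘ₗ g) := by
  rw [LinearMap.convMul_def, ← LinearMap.comp_assoc]
  congr 2
  ext; simp

/-- The product `m` of a bialgebra twisted by `σ` on the left and by `σ'` on the right,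
`x ⊗ y ↦ σ(x₁ ⊗ y₁) x₂ y₂ σ'(x₃ ⊗ y₃)`. -/
noncomputable def twMul (σ σ' : B ⊗[k] B →ₗ[k] k) : B ⊗[k] B →ₗ[k] B :=
  (scal B σ * toConv (LinearMap.mul' k B) * scal B σ').ofConv

variable {σ σ' : B ⊗[k] B →ₗ[k] k}

lemma comul_comp_twMul (h' : toConv σ' * toConv σ = 1) :
    comul ∘ₗ twMul σ σ' = TensorProduct.map (twMul σ σ') (twMul σ σ') ∘ₗ comul := by
  apply toConv_injective
  rw [map_comp_comul]
  have h1 : (comul : B →ₗ[k] B ⊗[k] B) = (Bialgebra.comulAlgHom k B).toLinearMap := rfl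
  have h2 : toConv ((comul : B →ₗ[k] B ⊗[k] B) ∘ₗ LinearMap.mul' k B) =
      toConv ((Algebra.TensorProduct.includeLeft : B →ₐ[k] B ⊗[k] B).toLinearMap ∘ₗ
        LinearMap.mul' k B) *
      toConv ((Algebra.TensorProduct.includeRight : B →ₐ[k] B ⊗[k] B).toLinearMap ∘ₗ
        LinearMap.mul' k B) := by
    rw [← map_comp_comul]
    exact congr(toConv $((Bialgebra.mulCoalgHom k B).map_comp_comul.symm))
  simp only [twMul, h1, LinearMap.algHom_comp_convMul_distrib, toConv_ofConv, algHom_scal,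
    ] at h2 ⊢
  rw [h2]
  simp only [mul_assoc]
  rw [← mul_assoc (scal _ σ') (scal _ σ), scal_mul_eq_one h', one_mul]

lemma counit_comp_twMul (h : toConv σ * toConv σ' = 1) : counit ∘ₗ twMul σ σ' = counit := by
  apply toConv_injective
  have h1 : (counit : B →ₗ[k] k) = (Bialgebra.counitAlgHom k B).toLinearMap := rfl
  have h2 : toConv ((counit : B →ₗ[k] k) ∘ₗ LinearMap.mul' k B) = 1 := by
    exact congr(toConv $((Bialgebra.mulCoalgHom k B).counit_comp))
  simp only [twMul, h1, LinearMap.algHom_comp_convMul_distrib, toConv_ofConv, algHom_scal,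
    ] at h2 ⊢
  rw [h2, mul_one, scal_mul_eq_one h]
  rfl

/-- The twisted product as a map of coalgebras. -/
noncomputable def twMulHom (h : toConv σ * toConv σ' = 1) (h' : toConv σ' * toConv σ = 1) :
    B ⊗[k] B →ₗc[k] B where
  toLinearMap := twMul σ σ'
  counit_comp := counit_comp_twMul h
  map_comp_comul := (comul_comp_twMul h').symm

lemma conv_comp (f g : WithConv (C →ₗ[k] X)) (φ : D →ₗc[k] C) :
    toConv ((f * g).ofConv ∘ₗ φ.toLinearMap) =
      toConv (f.ofConv ∘ₗ φ.toLinearMap) * toConv (g.ofConv ∘ₗ φ.toLinearMap) := by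
  rw [LinearMap.convMul_comp_coalgHom_distrib]

lemma scal_comp (s : C →ₗ[k] k) (φ : D →ₗc[k] C) :
    toConv ((scal X s).ofConv ∘ₗ φ.toLinearMap) = scal X (s ∘ₗ φ.toLinearMap) := rfl

lemma twMul_comp (φ : C →ₗc[k] B ⊗[k] B) :
    toConv (twMul σ σ' ∘ₗ φ.toLinearMap) = scal B (σ ∘ₗ φ.toLinearMap) *
      toConv (LinearMap.mul' k B ∘ₗ φ.toLinearMap) * scal B (σ' ∘ₗ φ.toLinearMap) := by
  simp only [twMul, conv_comp, scal_comp, ofConv_toConv]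

lemma twMul_comp_of_trivial (φ : C →ₗc[k] B ⊗[k] B) (h : σ ∘ₗ φ.toLinearMap = counit)
    (h' : σ' ∘ₗ φ.toLinearMap = counit) :
    twMul σ σ' ∘ₗ φ.toLinearMap = LinearMap.mul' k B ∘ₗ φ.toLinearMap := by
  apply toConv_injective
  have : scal B (counit : C →ₗ[k] k) = 1 := rfl
  rw [twMul_comp, h, h', this, one_mul, mul_one]


lemma sum_counit_smul_leftB' (d : D) :
    ∑ i ∈ (ℛ k d).index, counit (R := k) ((ℛ k d).right i) • (ℛ k d).left i = d := by
  simpa [-sum_tmul_counit_eq] using congr(TensorProduct.rid k D $(sum_tmul_counit_eq (R := k) (ℛ k d)))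

section
variable {C D : Type*} [Ring C] [Bialgebra k C] [Ring D] [Bialgebra k D]

lemma mul_algebraMap_eq_smul (x : X) (r : k) : x * algebraMap k X r = r • x := by
  rw [← Algebra.commutes, Algebra.smul_def]

lemma comp_scal_left (s s' : C →ₗ[k] k) (f : C →ₗ[k] B) (G : B ⊗[k] D →ₗ[k] X) :
    toConv (G ∘ₗ (scal B s * toConv f * scal B s').ofConv.rTensor D) =
      scal X (LinearMap.mul' k k ∘ₗ TensorProduct.map s counit) * toConv (G ∘ₗ f.rTensor D) *
      scal X (LinearMap.mul' k k ∘ₗ TensorProduct.map s' counit) := by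
  have h1 : ∀ f : WithConv (C →ₗ[k] B), toConv (G ∘ₗ (scal B s * f).ofConv.rTensor D) =
      scal X (LinearMap.mul' k k ∘ₗ TensorProduct.map s counit) *
        toConv (G ∘ₗ f.ofConv.rTensor D) := by
    intro f
    apply WithConv.ext
    ext c d
    have := ((ℛ k c).tmul (ℛ k d)).convMul_apply
      (scal X (LinearMap.mul' k k ∘ₗ TensorProduct.map s counit)) (toConv (G ∘ₗ f.ofConv.rTensor D))
    simp only [TensorProduct.AlgebraTensorModule.curry_apply, LinearMap.restrictScalars_self,
      TensorProduct.curry_apply]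
    rw [this]
    simp only [LinearMap.comp_apply, LinearMap.rTensor_tmul, (ℛ k c).convMul_apply]
    conv_lhs => rw [← sum_counit_smul (R := k) (ℛ k d)]
    simp [scal, Finset.sum_product, TensorProduct.sum_tmul, TensorProduct.tmul_sum,
      ← Algebra.smul_def, ← TensorProduct.smul_tmul', Finset.smul_sum, smul_smul, mul_comm]
    rw [Finset.sum_comm]
  have h2 : ∀ f : WithConv (C →ₗ[k] B), toConv (G ∘ₗ (f * scal B s').ofConv.rTensor D) =
        toConv (G ∘ₗ f.ofConv.rTensor D) *
      scal X (LinearMap.mul' k k ∘ₗ TensorProduct.map s' counit) := by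
    intro f
    apply WithConv.ext
    ext c d
    have := ((ℛ k c).tmul (ℛ k d)).convMul_apply (toConv (G ∘ₗ f.ofConv.rTensor D))
      (scal X (LinearMap.mul' k k ∘ₗ TensorProduct.map s' counit))
    simp only [TensorProduct.AlgebraTensorModule.curry_apply, LinearMap.restrictScalars_self,
      TensorProduct.curry_apply]
    rw [this]
    simp only [LinearMap.comp_apply, LinearMap.rTensor_tmul, (ℛ k c).convMul_apply]
    conv_lhs => rw [← sum_counit_smul_leftB' (k := k) d]
    simp [scal, Finset.sum_product, TensorProduct.sum_tmul, TensorProduct.tmul_sum,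
      mul_algebraMap_eq_smul, ← TensorProduct.smul_tmul', Finset.smul_sum, smul_smul, mul_comm]
    rw [Finset.sum_comm]
  rw [h2, h1]

lemma comp_scal_right (s s' : C →ₗ[k] k) (f : C →ₗ[k] B) (G : D ⊗[k] B →ₗ[k] X) :
    toConv (G ∘ₗ (scal B s * toConv f * scal B s').ofConv.lTensor D) =
      scal X (LinearMap.mul' k k ∘ₗ TensorProduct.map counit s) * toConv (G ∘ₗ f.lTensor D) *
      scal X (LinearMap.mul' k k ∘ₗ TensorProduct.map counit s') := by
  have h1 : ∀ f : WithConv (C →ₗ[k] B), toConv (G ∘ₗ (scal B s * f).ofConv.lTensor D) =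
      scal X (LinearMap.mul' k k ∘ₗ TensorProduct.map counit s) *
        toConv (G ∘ₗ f.ofConv.lTensor D) := by
    intro f
    apply WithConv.ext
    ext d c
    have := ((ℛ k d).tmul (ℛ k c)).convMul_apply
      (scal X (LinearMap.mul' k k ∘ₗ TensorProduct.map counit s)) (toConv (G ∘ₗ f.ofConv.lTensor D))
    simp only [TensorProduct.AlgebraTensorModule.curry_apply, LinearMap.restrictScalars_self,
      TensorProduct.curry_apply]
    rw [this]
    simp only [LinearMap.comp_apply, LinearMap.lTensor_tmul, (ℛ k c).convMul_apply]
    conv_lhs => rw [← sum_counit_smul (R := k) (ℛ k d)]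
    simp [scal, Finset.sum_product, TensorProduct.sum_tmul, TensorProduct.tmul_sum,
      ← Algebra.smul_def, ← TensorProduct.smul_tmul', Finset.smul_sum, smul_smul, mul_comm]
    rw [Finset.sum_comm]
  have h2 : ∀ f : WithConv (C →ₗ[k] B), toConv (G ∘ₗ (f * scal B s').ofConv.lTensor D) =
        toConv (G ∘ₗ f.ofConv.lTensor D) *
      scal X (LinearMap.mul' k k ∘ₗ TensorProduct.map counit s') := by
    intro f
    apply WithConv.ext
    ext d c
    have := ((ℛ k d).tmul (ℛ k c)).convMul_apply (toConv (G ∘ₗ f.ofConv.lTensor D))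
      (scal X (LinearMap.mul' k k ∘ₗ TensorProduct.map counit s'))
    simp only [TensorProduct.AlgebraTensorModule.curry_apply, LinearMap.restrictScalars_self,
      TensorProduct.curry_apply]
    rw [this]
    simp only [LinearMap.comp_apply, LinearMap.lTensor_tmul, (ℛ k c).convMul_apply]
    conv_lhs => rw [← sum_counit_smul_leftB' (k := k) d]
    simp [scal, Finset.sum_product, TensorProduct.sum_tmul, TensorProduct.tmul_sum,
      mul_algebraMap_eq_smul, ← TensorProduct.smul_tmul', Finset.smul_sum, smul_smul, mul_comm]
    rw [Finset.sum_comm]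
  rw [h2, h1]

end


lemma scal_self (s : C →ₗ[k] k) : scal k s = toConv s := rfl

lemma conv_pullback_eq_one {s t : C →ₗ[k] k} (h : toConv s * toConv t = 1) (φ : D →ₗc[k] C) :
    toConv (s ∘ₗ φ.toLinearMap) * toConv (t ∘ₗ φ.toLinearMap) = 1 := by
  have := conv_comp (toConv s) (toConv t) φ
  rw [h] at this
  rw [← this]
  exact congr(toConv (Algebra.linearMap k k ∘ₗ $φ.counit_comp))

lemma comp_scal_left_of_one (G : B ⊗[k] B →ₗ[k] X) :
    toConv (G ∘ₗ (scal B σ * toConv (LinearMap.mul' k B)).ofConv.rTensor B) =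
      scal X (LinearMap.mul' k k ∘ₗ TensorProduct.map σ counit) *
        toConv (G ∘ₗ (LinearMap.mul' k B).rTensor B) := by
  have h1 := comp_scal_left (D := B) σ counit (LinearMap.mul' k B) G
  have h2 : scal B (counit : B ⊗[k] B →ₗ[k] k) = 1 := rfl
  have h3 : LinearMap.mul' k k ∘ₗ TensorProduct.map (counit : B ⊗[k] B →ₗ[k] k)
      (counit : B →ₗ[k] k) = counit := by ext a b c; simp [mul_comm]
  have h4 : scal X (counit : (B ⊗[k] B) ⊗[k] B →ₗ[k] k) = 1 := rfl
  rwa [h2, h3, h4, mul_one, mul_one] at h1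

lemma comp_scal_right_of_one (G : B ⊗[k] B →ₗ[k] X) :
    toConv (G ∘ₗ (scal B σ * toConv (LinearMap.mul' k B)).ofConv.lTensor B) =
      scal X (LinearMap.mul' k k ∘ₗ TensorProduct.map counit σ) *
        toConv (G ∘ₗ (LinearMap.mul' k B).lTensor B) := by
  have h1 := comp_scal_right (D := B) σ counit (LinearMap.mul' k B) G
  have h2 : scal B (counit : B ⊗[k] B →ₗ[k] k) = 1 := rfl
  have h3 : LinearMap.mul' k k ∘ₗ TensorProduct.map (counit : B →ₗ[k] k)
      (counit : B ⊗[k] B →ₗ[k] k) = counit := by ext a b c; simp [mul_comm]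
  have h4 : scal X (counit : B ⊗[k] (B ⊗[k] B) →ₗ[k] k) = 1 := rfl
  rwa [h2, h3, h4, mul_one, mul_one] at h1

/-- A computation in a ring, used twice below. -/
lemma ring_aux {T E : Type*} [Ring T] [Ring E] (S : T → E) (hS : ∀ a b, S a * S b = S (a * b))
    (hS1 : S 1 = 1) {p p' c c' : T} (hp' : p' * p = 1) (M : E) :
    S (p * c * p') * (S p * M * S p') * S (p * c' * p') = S (p * c) * M * S (c' * p') := by
  simp only [← hS]
  have h : S p' * S p = 1 := by rw [hS, hp', hS1]
  calc _ = S p * S c * (S p' * S p) * M * (S p' * S p) * S c' * S p' := by simp only [mul_assoc]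
    _ = _ := by simp only [h, mul_one, mul_assoc]

lemma twMul_assoc_left (h : toConv σ * toConv σ' = 1) (h' : toConv σ' * toConv σ = 1) :
    ∃ d' : WithConv ((B ⊗[k] B) ⊗[k] B →ₗ[k] k),
      toConv (σ ∘ₗ (scal B σ * toConv (LinearMap.mul' k B)).ofConv.rTensor B) * d' = 1 ∧
      d' * toConv (σ ∘ₗ (scal B σ * toConv (LinearMap.mul' k B)).ofConv.rTensor B) = 1 ∧
      toConv (twMul σ σ' ∘ₗ (twMul σ σ').rTensor B) =
        scal B (σ ∘ₗ (scal B σ * toConv (LinearMap.mul' k B)).ofConv.rTensor B) *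
          toConv (LinearMap.mul' k B ∘ₗ (LinearMap.mul' k B).rTensor B) * scal B d'.ofConv := by
  let φ : (B ⊗[k] B) ⊗[k] B →ₗc[k] B ⊗[k] B :=
    Coalgebra.TensorProduct.map (twMulHom h h') (CoalgHom.id k B)
  let μ : (B ⊗[k] B) ⊗[k] B →ₗc[k] B ⊗[k] B :=
    Coalgebra.TensorProduct.map (Bialgebra.mulCoalgHom k B) (CoalgHom.id k B)
  have e1 : twMul σ σ' ∘ₗ (twMul σ σ').rTensor B = twMul σ σ' ∘ₗ φ.toLinearMap := rfl
  let π : (B ⊗[k] B) ⊗[k] B →ₗc[k] B ⊗[k] B :=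
    (Coalgebra.TensorProduct.rid k k (B ⊗[k] B) : _ →ₗc[k] _).comp
      (Coalgebra.TensorProduct.map (CoalgHom.id k _) (counitCoalgHom k B))
  have hπ : ∀ s : B ⊗[k] B →ₗ[k] k,
      LinearMap.mul' k k ∘ₗ TensorProduct.map s counit = s ∘ₗ π.toLinearMap := by
    intro s
    ext a b c
    simp [π, mul_comm]
  have A := fun s : B ⊗[k] B →ₗ[k] k => comp_scal_left (D := B) σ σ' (LinearMap.mul' k B) s
  simp only [hπ, scal_self] at A
  have A' := comp_scal_left (D := B) σ σ' (LinearMap.mul' k B) (LinearMap.mul' k B)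
  have e2 := comp_scal_left_of_one (σ := σ) σ
  simp only [hπ, scal_self] at A' e2
  refine ⟨toConv (σ' ∘ₗ μ.toLinearMap) * toConv (σ' ∘ₗ π.toLinearMap), ?_, ?_, ?_⟩
  · rw [e2]
    have h1 := conv_pullback_eq_one h π
    have h2 : toConv (σ ∘ₗ (LinearMap.mul' k B).rTensor B) * toConv (σ' ∘ₗ μ.toLinearMap) = 1 :=
      conv_pullback_eq_one h μ
    rw [mul_assoc, ← mul_assoc _ (toConv (σ' ∘ₗ μ.toLinearMap)), h2, one_mul, h1]
  · rw [e2]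
    have h1 := conv_pullback_eq_one h' π
    have h2 : toConv (σ' ∘ₗ μ.toLinearMap) * toConv (σ ∘ₗ (LinearMap.mul' k B).rTensor B) = 1 :=
      conv_pullback_eq_one h' μ
    rw [mul_assoc, ← mul_assoc _ (toConv (σ ∘ₗ π.toLinearMap)), h1, one_mul, h2]
  · rw [e1, twMul_comp]
    have a1 : σ ∘ₗ φ.toLinearMap = (toConv (σ ∘ₗ π.toLinearMap) *
      toConv (σ ∘ₗ (LinearMap.mul' k B).rTensor B) * toConv (σ' ∘ₗ π.toLinearMap)).ofConv :=
      congr(ofConv $(A σ))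
    have a2 : σ' ∘ₗ φ.toLinearMap = (toConv (σ ∘ₗ π.toLinearMap) *
      toConv (σ' ∘ₗ (LinearMap.mul' k B).rTensor B) * toConv (σ' ∘ₗ π.toLinearMap)).ofConv :=
      congr(ofConv $(A σ'))
    have a3 : toConv (LinearMap.mul' k B ∘ₗ φ.toLinearMap) = _ := A'
    have e2' := congr(ofConv $e2)
    simp only [ofConv_toConv] at e2'
    rw [a1, a2, a3, e2']
    exact ring_aux (fun s : WithConv ((B ⊗[k] B) ⊗[k] B →ₗ[k] k) => scal B s.ofConv)
      (fun a b => scal_mul a b) scal_one (conv_pullback_eq_one h' π) _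

lemma twMul_assoc_right (h : toConv σ * toConv σ' = 1) (h' : toConv σ' * toConv σ = 1) :
    ∃ d' : WithConv (B ⊗[k] (B ⊗[k] B) →ₗ[k] k),
      toConv (σ ∘ₗ (scal B σ * toConv (LinearMap.mul' k B)).ofConv.lTensor B) * d' = 1 ∧
      d' * toConv (σ ∘ₗ (scal B σ * toConv (LinearMap.mul' k B)).ofConv.lTensor B) = 1 ∧
      toConv (twMul σ σ' ∘ₗ (twMul σ σ').lTensor B) =
        scal B (σ ∘ₗ (scal B σ * toConv (LinearMap.mul' k B)).ofConv.lTensor B) *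
          toConv (LinearMap.mul' k B ∘ₗ (LinearMap.mul' k B).lTensor B) * scal B d'.ofConv := by
  let φ : B ⊗[k] (B ⊗[k] B) →ₗc[k] B ⊗[k] B :=
    Coalgebra.TensorProduct.map (CoalgHom.id k B) (twMulHom h h')
  let μ : B ⊗[k] (B ⊗[k] B) →ₗc[k] B ⊗[k] B :=
    Coalgebra.TensorProduct.map (CoalgHom.id k B) (Bialgebra.mulCoalgHom k B)
  have e1 : twMul σ σ' ∘ₗ (twMul σ σ').lTensor B = twMul σ σ' ∘ₗ φ.toLinearMap := rfl
  let π : B ⊗[k] (B ⊗[k] B) →ₗc[k] B ⊗[k] B :=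
    (Coalgebra.TensorProduct.lid k (B ⊗[k] B) : _ →ₗc[k] _).comp
      (Coalgebra.TensorProduct.map (counitCoalgHom k B) (CoalgHom.id k _))
  have hπ : ∀ s : B ⊗[k] B →ₗ[k] k,
      LinearMap.mul' k k ∘ₗ TensorProduct.map counit s = s ∘ₗ π.toLinearMap := by
    intro s
    ext a b c
    simp [π]
  have A := fun s : B ⊗[k] B →ₗ[k] k => comp_scal_right (D := B) σ σ' (LinearMap.mul' k B) s
  simp only [hπ, scal_self] at A
  have A' := comp_scal_right (D := B) σ σ' (LinearMap.mul' k B) (LinearMap.mul' k B)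
  have e2 := comp_scal_right_of_one (σ := σ) σ
  simp only [hπ, scal_self] at A' e2
  refine ⟨toConv (σ' ∘ₗ μ.toLinearMap) * toConv (σ' ∘ₗ π.toLinearMap), ?_, ?_, ?_⟩
  · rw [e2]
    have h1 := conv_pullback_eq_one h π
    have h2 : toConv (σ ∘ₗ (LinearMap.mul' k B).lTensor B) * toConv (σ' ∘ₗ μ.toLinearMap) = 1 :=
      conv_pullback_eq_one h μ
    rw [mul_assoc, ← mul_assoc _ (toConv (σ' ∘ₗ μ.toLinearMap)), h2, one_mul, h1]
  · rw [e2]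
    have h1 := conv_pullback_eq_one h' π
    have h2 : toConv (σ' ∘ₗ μ.toLinearMap) * toConv (σ ∘ₗ (LinearMap.mul' k B).lTensor B) = 1 :=
      conv_pullback_eq_one h' μ
    rw [mul_assoc, ← mul_assoc _ (toConv (σ ∘ₗ π.toLinearMap)), h1, one_mul, h2]
  · rw [e1, twMul_comp]
    have a1 : σ ∘ₗ φ.toLinearMap = (toConv (σ ∘ₗ π.toLinearMap) *
      toConv (σ ∘ₗ (LinearMap.mul' k B).lTensor B) * toConv (σ' ∘ₗ π.toLinearMap)).ofConv :=
      congr(ofConv $(A σ))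
    have a2 : σ' ∘ₗ φ.toLinearMap = (toConv (σ ∘ₗ π.toLinearMap) *
      toConv (σ' ∘ₗ (LinearMap.mul' k B).lTensor B) * toConv (σ' ∘ₗ π.toLinearMap)).ofConv :=
      congr(ofConv $(A σ'))
    have a3 : toConv (LinearMap.mul' k B ∘ₗ φ.toLinearMap) = _ := A'
    have e2' := congr(ofConv $e2)
    simp only [ofConv_toConv] at e2'
    rw [a1, a2, a3, e2']
    exact ring_aux (fun s : WithConv (B ⊗[k] (B ⊗[k] B) →ₗ[k] k) => scal B s.ofConv)
      (fun a b => scal_mul a b) scal_one (conv_pullback_eq_one h' π) _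

/-- The twisted product is associative if `σ` is a cocycle. -/
lemma twMul_assoc (h : toConv σ * toConv σ' = 1) (h' : toConv σ' * toConv σ = 1)
    (hσ : σ ∘ₗ (scal B σ * toConv (LinearMap.mul' k B)).ofConv.rTensor B =
      (σ ∘ₗ (scal B σ * toConv (LinearMap.mul' k B)).ofConv.lTensor B) ∘ₗ
        (TensorProduct.assoc k B B B).toLinearMap) :
    twMul σ σ' ∘ₗ (twMul σ σ').rTensor B =
      (twMul σ σ' ∘ₗ (twMul σ σ').lTensor B) ∘ₗ (TensorProduct.assoc k B B B).toLinearMap := by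
  apply toConv_injective
  let α : (B ⊗[k] B) ⊗[k] B →ₗc[k] B ⊗[k] (B ⊗[k] B) :=
    (Coalgebra.TensorProduct.assoc k k B B B : _ →ₗc[k] _)
  have e3 : (TensorProduct.assoc k B B B).toLinearMap = α.toLinearMap := rfl
  obtain ⟨d, hd1, hd2, hd⟩ := twMul_assoc_left h h'
  obtain ⟨e, he1, he2, he⟩ := twMul_assoc_right h h'
  have he' := congr(toConv (ofConv $he ∘ₗ α.toLinearMap))
  rw [conv_comp, conv_comp] at he'
  simp only [scal_comp, ofConv_toConv] at he'
  rw [hd, e3, he', ← e3, ← hσ]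
  have hm : (LinearMap.mul' k B ∘ₗ (LinearMap.mul' k B).lTensor B) ∘ₗ
      (TensorProduct.assoc k B B B).toLinearMap =
      LinearMap.mul' k B ∘ₗ (LinearMap.mul' k B).rTensor B := by ext; simp [mul_assoc]
  have hde : d = toConv (e.ofConv ∘ₗ (TensorProduct.assoc k B B B).toLinearMap) := by
    refine left_inv_eq_right_inv hd2 ?_
    rw [hσ]
    exact conv_pullback_eq_one he1 α
  rw [hm, hde]

lemma twMul_assoc_apply (h : toConv σ * toConv σ' = 1) (h' : toConv σ' * toConv σ = 1)
    (hσ : σ ∘ₗ (scal B σ * toConv (LinearMap.mul' k B)).ofConv.rTensor B =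
      (σ ∘ₗ (scal B σ * toConv (LinearMap.mul' k B)).ofConv.lTensor B) ∘ₗ
        (TensorProduct.assoc k B B B).toLinearMap) (a b c : B) :
    twMul σ σ' (twMul σ σ' (a ⊗ₜ b) ⊗ₜ c) = twMul σ σ' (a ⊗ₜ twMul σ σ' (b ⊗ₜ c)) :=
  congr($(twMul_assoc h h' hσ) ((a ⊗ₜ b) ⊗ₜ c))

lemma comul_twMul_apply (h' : toConv σ' * toConv σ = 1) (a b : B) :
    comul (twMul σ σ' (a ⊗ₜ b)) = TensorProduct.map (twMul σ σ') (twMul σ σ')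
      (TensorProduct.tensorTensorTensorComm k B B B B (comul a ⊗ₜ comul b)) :=
  congr($(comul_comp_twMul h') (a ⊗ₜ b))

lemma counit_twMul_apply (h : toConv σ * toConv σ' = 1) (a b : B) :
    counit (R := k) (twMul σ σ' (a ⊗ₜ b)) = counit (R := k) a * counit (R := k) b := by
  have := congr($(counit_comp_twMul h) (a ⊗ₜ b))
  rw [mul_comm]
  exact this

variable (k B) in
/-- A convolution-invertible normalised (left) `2`-cocycle `σ` on a bialgebra `B`, with its
convolution inverse `σ'`. The cocycle identity is
`σ(a₁ ⊗ b₁) σ(a₂ b₂ ⊗ c) = σ(b₁ ⊗ c₁) σ(a ⊗ b₂ c₂)`. -/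
structure Cocycle where
  /-- the cocycle -/
  σ : B ⊗[k] B →ₗ[k] k
  /-- the convolution inverse of the cocycle -/
  σ' : B ⊗[k] B →ₗ[k] k
  mul_inv : toConv σ * toConv σ' = 1
  inv_mul : toConv σ' * toConv σ = 1
  one_left : ∀ b, σ (1 ⊗ₜ b) = counit b
  one_right : ∀ b, σ (b ⊗ₜ 1) = counit b
  cocycle : σ ∘ₗ (scal B σ * toConv (LinearMap.mul' k B)).ofConv.rTensor B =
      (σ ∘ₗ (scal B σ * toConv (LinearMap.mul' k B)).ofConv.lTensor B) ∘ₗ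
        (TensorProduct.assoc k B B B).toLinearMap

variable (S : Cocycle k B)

lemma Cocycle.comp_inv {φ : C →ₗc[k] B ⊗[k] B} (h : S.σ ∘ₗ φ.toLinearMap = counit) :
    S.σ' ∘ₗ φ.toLinearMap = counit := by
  have h1 := conv_pullback_eq_one S.mul_inv φ
  have h2 : toConv (counit : C →ₗ[k] k) = 1 := rfl
  rw [h, h2, one_mul] at h1
  exact congr(ofConv $h1)

lemma Cocycle.twMul_of_trivial (φ : C →ₗc[k] B ⊗[k] B) (h : S.σ ∘ₗ φ.toLinearMap = counit)
    (c : C) : twMul S.σ S.σ' (φ c) = LinearMap.mul' k B (φ c) :=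
  congr($(twMul_comp_of_trivial φ h (S.comp_inv h)) c)

lemma Cocycle.one_twMul (b : B) : twMul S.σ S.σ' (1 ⊗ₜ b) = b := by
  have := S.twMul_of_trivial
    ((Coalgebra.TensorProduct.map (Bialgebra.unitBialgHom k B : k →ₗc[k] B)
      (CoalgHom.id k B)).comp ((Coalgebra.TensorProduct.lid k B).symm : B →ₗc[k] _))
    (by ext b; simp [S.one_left]) b
  simpa using this

lemma Cocycle.twMul_one (b : B) : twMul S.σ S.σ' (b ⊗ₜ 1) = b := by
  have := S.twMul_of_trivial
    ((Coalgebra.TensorProduct.map (CoalgHom.id k B) (Bialgebra.unitBialgHom k B : k →ₗc[k] B)).comp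
      ((Coalgebra.TensorProduct.rid k k B).symm : B →ₗc[k] _))
    (by ext b; simp [S.one_right]) b
  simpa using this

/-- The cocycle twist of a bialgebra `B`: the coalgebra `B` with the twisted product
`x · y = σ(x₁ ⊗ y₁) x₂ y₂ σ⁻¹(x₃ ⊗ y₃)`. -/
def CocycleTwist (_S : Cocycle k B) : Type _ := B

namespace CocycleTwist

noncomputable instance : Ring (CocycleTwist S) where
  __ := (inferInstanceAs (AddCommGroup B) : AddCommGroup (CocycleTwist S))
  mul x y := twMul S.σ S.σ' ((show B from x) ⊗ₜ (show B from y))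
  one := (1 : B)
  mul_assoc x y z := twMul_assoc_apply S.mul_inv S.inv_mul S.cocycle x y z
  one_mul := S.one_twMul
  mul_one := S.twMul_one
  left_distrib x y z :=
    (congrArg (twMul S.σ S.σ') (TensorProduct.tmul_add (R := k) (M := B) (N := B) x y z)).trans
      (map_add _ _ _)
  right_distrib x y z :=
    (congrArg (twMul S.σ S.σ') (TensorProduct.add_tmul (R := k) (M := B) (N := B) x y z)).trans
      (map_add _ _ _)
  zero_mul x :=
    (congrArg (twMul S.σ S.σ') (TensorProduct.zero_tmul (R := k) (M := B) (N := B) x)).trans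
      (map_zero _)
  mul_zero x :=
    (congrArg (twMul S.σ S.σ') (TensorProduct.tmul_zero (R := k) (M := B) (N := B) x)).trans
      (map_zero _)

noncomputable instance : Module k (CocycleTwist S) := inferInstanceAs (Module k B)

/-- The identity map, as a linear equivalence of `B` with its twist. -/
def of : B ≃ₗ[k] CocycleTwist S := LinearEquiv.refl k B

lemma of_mul (x y : B) : of S x * of S y = of S (twMul S.σ S.σ' (x ⊗ₜ y)) := rfl

lemma of_one : of S 1 = 1 := rfl

noncomputable instance : Algebra k (CocycleTwist S) :=
  Algebra.ofModule
    (fun r x y => (congrArg (twMul S.σ S.σ')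
      (TensorProduct.smul_tmul' (R := k) (M := B) (N := B) r x y).symm).trans (map_smul _ _ _))
    (fun r x y => (congrArg (twMul S.σ S.σ')
      (TensorProduct.tmul_smul (R := k) (M := B) (N := B) r x y)).trans (map_smul _ _ _))

noncomputable instance : Coalgebra k (CocycleTwist S) := inferInstanceAs (Coalgebra k B)

noncomputable instance : Bialgebra k (CocycleTwist S) :=
  Bialgebra.mk' k (CocycleTwist S)
    (Bialgebra.counit_one (R := k) (A := B))
    (by intro x y; exact counit_twMul_apply (B := B) S.mul_inv x y)
    (Bialgebra.comul_one (R := k) (A := B))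
    (by
      intro x y
      refine (comul_twMul_apply (B := B) S.inv_mul x y).trans ?_
      have h := LinearMap.congr_fun
        (TensorProduct.Algebra.mul'_comp_tensorTensorTensorComm (R := k)
          (A := CocycleTwist S) (B := CocycleTwist S)) (TensorProduct.tensorTensorTensorComm k (CocycleTwist S)
            (CocycleTwist S) (CocycleTwist S) (CocycleTwist S)
              (comul (R := k) x ⊗ₜ comul (R := k) y))
      have h' := (TensorProduct.tensorTensorTensorComm k (CocycleTwist S)
            (CocycleTwist S) (CocycleTwist S) (CocycleTwist S)).symm_apply_apply
              (comul (R := k) x ⊗ₜ comul (R := k) y)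
      rw [TensorProduct.tensorTensorTensorComm_symm] at h'
      refine Eq.trans ?_ (h.symm.trans ((congrArg
        (LinearMap.mul' k (CocycleTwist S ⊗[k] CocycleTwist S)) h').trans
          (LinearMap.mul'_apply (R := k))))
      have e : twMul S.σ S.σ' = LinearMap.mul' k (CocycleTwist S) :=
        TensorProduct.ext' fun _ _ => rfl
      rw [← e]
      rfl)

end CocycleTwist

end Twist

section Antipode
variable (k H : Type*) [Field k] [Ring H] [HopfAlgebra k H] [FiniteDimensional k H]

/-- The inverse `S⁻¹` of the antipode of a finite-dimensional Hopf algebra. -/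
noncomputable def antipodeInv : H →ₗ[k] H :=
  (LinearEquiv.ofBijective (antipode k : H →ₗ[k] H) antipode_bijective).symm.toLinearMap

variable {k H}

@[simp] lemma antipodeInv_antipode (x : H) : antipodeInv k H (antipode k x) = x :=
  (LinearEquiv.ofBijective (antipode k : H →ₗ[k] H) antipode_bijective).symm_apply_apply x

@[simp] lemma antipode_antipodeInv (x : H) : antipode k (antipodeInv k H x) = x :=
  (LinearEquiv.ofBijective (antipode k : H →ₗ[k] H) antipode_bijective).apply_symm_apply x

lemma antipodeInv_mul (x y : H) :
    antipodeInv k H (x * y) = antipodeInv k H y * antipodeInv k H x := by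
  apply antipode_bijective (k := k).1
  simp [antipode_mul_antidistrib]

@[simp] lemma antipodeInv_one : antipodeInv k H 1 = 1 := by
  apply antipode_bijective (k := k).1
  simp

lemma sum_mul_antipodeInv (x : H) : ∑ i ∈ (ℛ k x).index,
    (ℛ k x).right i * antipodeInv k H ((ℛ k x).left i) = counit (R := k) x • 1 := by
  apply antipode_bijective (k := k).1
  simp [antipode_mul_antidistrib, sum_mul_antipode_eq_smul]

lemma sum_antipodeInv_mul (x : H) : ∑ i ∈ (ℛ k x).index,
    antipodeInv k H ((ℛ k x).right i) * (ℛ k x).left i = counit (R := k) x • 1 := by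
  apply antipode_bijective (k := k).1
  simp [antipode_mul_antidistrib, sum_antipode_mul_eq_smul]

end Antipode

/-- The underlying space of the Hopf algebra `H^{*cop}`: linear functionals on `H`. The algebra
structure of `WithConv (H →ₗ[k] k)` is the convolution product dual to the comultiplication:
`(p q)(x) = p(x₁) q(x₂)`, with unit `ε`. -/
def DualCop (k H : Type*) [Field k] [Ring H] [HopfAlgebra k H] : Type _ := WithConv (H →ₗ[k] k)

namespace DualCop
section
variable (k H : Type*) [Field k] [Ring H] [HopfAlgebra k H]

noncomputable instance : Ring (DualCop k H) := inferInstanceAs (Ring (WithConv (H →ₗ[k] k)))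
noncomputable instance : Algebra k (DualCop k H) :=
  inferInstanceAs (Algebra k (WithConv (H →ₗ[k] k)))

/-- The identification of `H^{*cop}` with the dual space of `H`. -/
noncomputable def toDual : DualCop k H ≃ₗ[k] Module.Dual k H := WithConv.linearEquiv k (H →ₗ[k] k)

variable {k H}

lemma ext' {p q : DualCop k H} (h : ∀ x, toDual k H p x = toDual k H q x) : p = q :=
  (toDual k H).injective (LinearMap.ext h)

lemma toDual_mul (p q : DualCop k H) (x : H) : toDual k H (p * q) x =
    ∑ i ∈ (ℛ k x).index, toDual k H p ((ℛ k x).left i) * toDual k H q ((ℛ k x).right i) :=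
  (ℛ k x).convMul_apply (show WithConv (H →ₗ[k] k) from p) q

@[simp] lemma toDual_one (x : H) : toDual k H 1 x = counit x := rfl

lemma toDual_mul' (p q : DualCop k H) (x : H) : toDual k H (p * q) x =
    TensorProduct.dualDistrib k H H (toDual k H p ⊗ₜ toDual k H q) (comul x) := by
  rw [toDual_mul, ← (ℛ k x).eq]; simp

end

variable (k H : Type*) [Field k] [Ring H] [HopfAlgebra k H] [FiniteDimensional k H]

instance : FiniteDimensional k (DualCop k H) := Module.Finite.equiv (toDual k H).symm

/-- The identification of `H* ⊗ H*` with `(H ⊗ H)*`. -/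
noncomputable def pair : DualCop k H ⊗[k] DualCop k H ≃ₗ[k] Module.Dual k (H ⊗[k] H) :=
  TensorProduct.congr (toDual k H) (toDual k H) ≪≫ₗ TensorProduct.dualDistribEquiv k H H

/-- The identification of `H* ⊗ (H* ⊗ H*)` with `(H ⊗ (H ⊗ H))*`. -/
noncomputable def pair₃ : DualCop k H ⊗[k] (DualCop k H ⊗[k] DualCop k H) ≃ₗ[k]
    Module.Dual k (H ⊗[k] (H ⊗[k] H)) :=
  TensorProduct.congr (toDual k H) (pair k H) ≪≫ₗ TensorProduct.dualDistribEquiv k H (H ⊗[k] H)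

variable {k H}

@[simp] lemma pair_tmul (p q : DualCop k H) (x y : H) :
    pair k H (p ⊗ₜ q) (x ⊗ₜ y) = toDual k H p x * toDual k H q y := rfl

@[simp] lemma pair₃_tmul (p : DualCop k H) (t : DualCop k H ⊗[k] DualCop k H) (x : H)
    (y : H ⊗[k] H) :
    pair₃ k H (p ⊗ₜ t) (x ⊗ₜ y) = toDual k H p x * pair k H t y := rfl

lemma pair_ext {s t : DualCop k H ⊗[k] DualCop k H}
    (h : ∀ x y, pair k H s (x ⊗ₜ y) = pair k H t (x ⊗ₜ y)) : s = t :=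
  (pair k H).injective (TensorProduct.ext' h)

variable (k H)

/-- The comultiplication of `H^{*cop}`: the element `Δ p` of `H* ⊗ H* = (H ⊗ H)*` is
`x ⊗ y ↦ p (y x)`. -/
noncomputable def comulLin : DualCop k H →ₗ[k] DualCop k H ⊗[k] DualCop k H :=
  (pair k H).symm.toLinearMap ∘ₗ
    (LinearMap.mul' k H ∘ₗ (TensorProduct.comm k H H).toLinearMap).dualMap ∘ₗ
      (toDual k H).toLinearMap

/-- The counit of `H^{*cop}`: evaluation at `1`. -/
noncomputable def counitLin : DualCop k H →ₗ[k] k := Module.Dual.eval k H 1 ∘ₗ (toDual k H).toLinearMap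

noncomputable instance : CoalgebraStruct k (DualCop k H) where
  comul := comulLin k H
  counit := counitLin k H

variable {k H}

@[simp] lemma pair_comul (p : DualCop k H) (x y : H) :
    pair k H (comul p) (x ⊗ₜ y) = toDual k H p (y * x) := by
  change pair k H (comulLin k H p) _ = _
  simp [comulLin]

@[simp] lemma counit_eq (p : DualCop k H) : counit p = toDual k H p 1 := rfl

lemma pair₃_lTensor (t : DualCop k H ⊗[k] DualCop k H) (x y z : H) :
    pair₃ k H (comul.lTensor _ t) (x ⊗ₜ (y ⊗ₜ z)) = pair k H t (x ⊗ₜ (z * y)) := by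
  induction t with
  | zero => simp
  | add s t hs ht => simp [hs, ht]
  | tmul p q => simp

lemma pair₃_rTensor (t : DualCop k H ⊗[k] DualCop k H) (x y z : H) :
    pair₃ k H (TensorProduct.assoc k _ _ _ (comul.rTensor _ t)) (x ⊗ₜ (y ⊗ₜ z)) =
      pair k H t ((y * x) ⊗ₜ z) := by
  induction t with
  | zero => simp
  | add s t hs ht => simp [hs, ht]
  | tmul p q =>
    have : ∀ s : DualCop k H ⊗[k] DualCop k H, pair₃ k H (TensorProduct.assoc k _ _ _ (s ⊗ₜ q))
        (x ⊗ₜ (y ⊗ₜ z)) = pair k H s (x ⊗ₜ y) * toDual k H q z := by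
      intro s
      induction s with
      | zero => simp
      | add s t hs ht => simp [hs, ht, TensorProduct.add_tmul, add_mul]
      | tmul p q => simp [mul_assoc]
    simp [this]

noncomputable instance : Coalgebra k (DualCop k H) where
  coassoc := by
    ext p
    apply (pair₃ k H).injective
    ext x y z
    simp [pair₃_lTensor, pair₃_rTensor, mul_assoc]
  rTensor_counit_comp_comul := by
    ext p
    apply (TensorProduct.lid k _).injective
    refine ext' fun x => ?_
    have : ∀ s : DualCop k H ⊗[k] DualCop k H, toDual k H (TensorProduct.lid k _
        ((counit : DualCop k H →ₗ[k] k).rTensor _ s)) x = pair k H s (1 ⊗ₜ x) := by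
      intro s
      induction s with
      | zero => simp
      | add s t hs ht => simp [hs, ht]
      | tmul p q => simp
    simp [this]
  lTensor_counit_comp_comul := by
    ext p
    apply (TensorProduct.rid k _).injective
    refine ext' fun x => ?_
    have : ∀ s : DualCop k H ⊗[k] DualCop k H, toDual k H (TensorProduct.rid k _
        ((counit : DualCop k H →ₗ[k] k).lTensor _ s)) x = pair k H s (x ⊗ₜ 1) := by
      intro s
      induction s with
      | zero => simp
      | add s t hs ht => simp [hs, ht]
      | tmul p q => simp [mul_comm]
    simp [this]

lemma pair_mul (s t : DualCop k H ⊗[k] DualCop k H) (x y : H) : pair k H (s * t) (x ⊗ₜ y) =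
    ∑ i ∈ (ℛ k x).index, ∑ j ∈ (ℛ k y).index,
      pair k H s ((ℛ k x).left i ⊗ₜ (ℛ k y).left j) *
      pair k H t ((ℛ k x).right i ⊗ₜ (ℛ k y).right j) := by
  induction s with
  | zero => simp
  | add s s' hs hs' => simp [hs, hs', add_mul, Finset.sum_add_distrib]
  | tmul p q =>
    induction t with
    | zero => simp
    | add s s' hs hs' => simp [hs, hs', mul_add, Finset.sum_add_distrib]
    | tmul p' q' =>
      simp only [Algebra.TensorProduct.tmul_mul_tmul, pair_tmul, toDual_mul, Finset.sum_mul_sum]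
      exact Finset.sum_congr rfl fun i _ => Finset.sum_congr rfl fun j _ => by ring

noncomputable instance : Bialgebra k (DualCop k H) :=
  Bialgebra.mk' k (DualCop k H) (by simp)
    (by intro p q; simp [toDual_mul', Algebra.TensorProduct.one_def])
    (by
      apply pair_ext
      intro x y
      simp [Algebra.TensorProduct.one_def, mul_comm])
    (by
      intro p q
      apply pair_ext
      intro x y
      rw [pair_mul, pair_comul, toDual_mul', Bialgebra.comul_mul]
      conv_lhs => rw [← (ℛ k x).eq, ← (ℛ k y).eq]
      simp [Finset.sum_mul_sum]
      rw [Finset.sum_comm])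

/-- The antipode of `H^{*cop}` is the transpose of `S⁻¹`. -/
noncomputable def antipodeLin : DualCop k H →ₗ[k] DualCop k H :=
  (toDual k H).symm.toLinearMap ∘ₗ (antipodeInv k H).dualMap ∘ₗ (toDual k H).toLinearMap

lemma toDual_mul'' (t : DualCop k H ⊗[k] DualCop k H) (x : H) :
    toDual k H (LinearMap.mul' k _ t) x = pair k H t (comul x) := by
  induction t with
  | zero => simp
  | add s t hs ht => simp [hs, ht]
  | tmul p q => rw [LinearMap.mul'_apply, toDual_mul']; rfl

@[simp] lemma toDual_antipodeLin (p : DualCop k H) (x : H) :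
    toDual k H (antipodeLin p) x = toDual k H p (antipodeInv k H x) := by
  simp [antipodeLin]

lemma pair_rTensor_antipodeLin (t : DualCop k H ⊗[k] DualCop k H) (x y : H) :
    pair k H (antipodeLin.rTensor _ t) (x ⊗ₜ y) = pair k H t (antipodeInv k H x ⊗ₜ y) := by
  induction t with
  | zero => simp
  | add s t hs ht => simp [hs, ht]
  | tmul p q => simp

lemma pair_lTensor_antipodeLin (t : DualCop k H ⊗[k] DualCop k H) (x y : H) :
    pair k H (antipodeLin.lTensor _ t) (x ⊗ₜ y) = pair k H t (x ⊗ₜ antipodeInv k H y) := by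
  induction t with
  | zero => simp
  | add s t hs ht => simp [hs, ht]
  | tmul p q => simp

noncomputable instance : HopfAlgebra k (DualCop k H) where
  antipode := antipodeLin
  mul_antipode_rTensor_comul := by
    ext p
    refine ext' fun x => ?_
    simp only [LinearMap.comp_apply, toDual_mul'']
    conv_lhs => rw [← (ℛ k x).eq]
    simp only [map_sum, pair_rTensor_antipodeLin, pair_comul]
    rw [← map_sum, sum_mul_antipodeInv]
    simp [Algebra.algebraMap_eq_smul_one, mul_comm]
  mul_antipode_lTensor_comul := by
    ext p
    refine ext' fun x => ?_
    simp only [LinearMap.comp_apply, toDual_mul'']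
    conv_lhs => rw [← (ℛ k x).eq]
    simp only [map_sum, pair_lTensor_antipodeLin, pair_comul]
    rw [← map_sum, sum_antipodeInv_mul]
    simp [Algebra.algebraMap_eq_smul_one, mul_comm]

end DualCop

open WithConv DualCop

section Pairing
variable (k H : Type*) [Field k] [Ring H] [HopfAlgebra k H] [FiniteDimensional k H]

/-- The projection `H^{*cop} ⊗ H → H`, `p ⊗ h ↦ p(1) h`. -/
noncomputable def projR : DualCop k H ⊗[k] H →ₗc[k] H :=
  (Coalgebra.TensorProduct.lid k H : k ⊗[k] H →ₗc[k] H).comp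
    (Coalgebra.TensorProduct.map (counitCoalgHom k (DualCop k H)) (CoalgHom.id k H))

/-- The projection `H^{*cop} ⊗ H → H^{*cop}`, `p ⊗ h ↦ ε(h) p`. -/
noncomputable def projL : DualCop k H ⊗[k] H →ₗc[k] DualCop k H :=
  (Coalgebra.TensorProduct.rid k k (DualCop k H) : DualCop k H ⊗[k] k →ₗc[k] _).comp
    (Coalgebra.TensorProduct.map (CoalgHom.id k _) (counitCoalgHom k H))

variable {k H}

@[simp] lemma projR_tmul (p : DualCop k H) (h : H) : projR k H (p ⊗ₜ h) = toDual k H p 1 • h := rfl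

@[simp] lemma projL_tmul (p : DualCop k H) (h : H) :
    projL k H (p ⊗ₜ h) = counit (R := k) h • p := rfl

variable (k H)

/-- The evaluation pairing `h ⊗ q ↦ q(h)`. -/
noncomputable def ev : H ⊗[k] DualCop k H →ₗ[k] k :=
  TensorProduct.lift ((toDual k H).toLinearMap.flip)

/-- The pairing `h ⊗ q ↦ q(S⁻¹ h)`. -/
noncomputable def evInv : H ⊗[k] DualCop k H →ₗ[k] k :=
  TensorProduct.lift ((toDual k H).toLinearMap.flip ∘ₗ antipodeInv k H)

variable {k H}

@[simp] lemma ev_tmul (h : H) (q : DualCop k H) : ev k H (h ⊗ₜ q) = toDual k H q h := rfl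

@[simp] lemma evInv_tmul (h : H) (q : DualCop k H) :
    evInv k H (h ⊗ₜ q) = toDual k H q (antipodeInv k H h) := rfl

lemma sum_pair_comul (q : DualCop k H) (x y : H) : ∑ j ∈ (ℛ k q).index,
    toDual k H ((ℛ k q).left j) x * toDual k H ((ℛ k q).right j) y = toDual k H q (y * x) := by
  rw [← pair_comul]; conv_rhs => rw [← (ℛ k q).eq]
  simp

lemma ev_mul_evInv : toConv (ev k H) * toConv (evInv k H) = 1 := by
  apply WithConv.ext
  ext h q
  have := ((ℛ k h).tmul (ℛ k q)).convMul_apply (toConv (ev k H)) (toConv (evInv k H))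
  simp only [TensorProduct.AlgebraTensorModule.curry_apply, LinearMap.restrictScalars_self,
      TensorProduct.curry_apply]
  rw [this]
  simp [Finset.sum_product, sum_pair_comul]
  rw [← map_sum, sum_antipodeInv_mul]
  simp [mul_comm]

lemma evInv_mul_ev : toConv (evInv k H) * toConv (ev k H) = 1 := by
  apply WithConv.ext
  ext h q
  have := ((ℛ k h).tmul (ℛ k q)).convMul_apply (toConv (evInv k H)) (toConv (ev k H))
  simp only [TensorProduct.AlgebraTensorModule.curry_apply, LinearMap.restrictScalars_self,
      TensorProduct.curry_apply]
  rw [this]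
  simp [Finset.sum_product, sum_pair_comul]
  rw [← map_sum, sum_mul_antipodeInv]
  simp [mul_comm]

variable (k H)

/-- `projR ⊗ projL`. -/
noncomputable def proj : (DualCop k H ⊗[k] H) ⊗[k] (DualCop k H ⊗[k] H) →ₗc[k]
    H ⊗[k] DualCop k H :=
  Coalgebra.TensorProduct.map (projR k H) (projL k H)

/-- The cocycle `(p ⊗ h) ⊗ (q ⊗ g) ↦ p(1) q(h) ε(g)`. -/
noncomputable def sigma : (DualCop k H ⊗[k] H) ⊗[k] (DualCop k H ⊗[k] H) →ₗ[k] k :=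
  ev k H ∘ₗ (proj k H).toLinearMap

/-- The convolution inverse `(p ⊗ h) ⊗ (q ⊗ g) ↦ p(1) q(S⁻¹ h) ε(g)` of the cocycle. -/
noncomputable def sigmaInv : (DualCop k H ⊗[k] H) ⊗[k] (DualCop k H ⊗[k] H) →ₗ[k] k :=
  evInv k H ∘ₗ (proj k H).toLinearMap

variable {k H}

@[simp] lemma sigma_tmul (p q : DualCop k H) (h g : H) :
    sigma k H ((p ⊗ₜ h) ⊗ₜ (q ⊗ₜ g)) =
      toDual k H p 1 * toDual k H q h * counit (R := k) g := by
  simp [sigma, proj, mul_comm]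

@[simp] lemma sigmaInv_tmul (p q : DualCop k H) (h g : H) :
    sigmaInv k H ((p ⊗ₜ h) ⊗ₜ (q ⊗ₜ g)) =
      toDual k H p 1 * toDual k H q (antipodeInv k H h) * counit (R := k) g := by
  simp [sigmaInv, proj, mul_comm]

lemma sigma_mul_sigmaInv : toConv (sigma k H) * toConv (sigmaInv k H) = 1 :=
  conv_pullback_eq_one ev_mul_evInv _

lemma sigmaInv_mul_sigma : toConv (sigmaInv k H) * toConv (sigma k H) = 1 :=
  conv_pullback_eq_one evInv_mul_ev _

lemma sum_counit_toDual (p : DualCop k H) :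
    ∑ i ∈ (ℛ k p).index, toDual k H ((ℛ k p).left i) 1 • (ℛ k p).right i = p :=
  sum_counit_smul (R := k) (ℛ k p)

lemma scal_sigma_mul (p q : DualCop k H) (h g : H) :
    (scal (DualCop k H ⊗[k] H) (sigma k H) *
      toConv (LinearMap.mul' k (DualCop k H ⊗[k] H))).ofConv ((p ⊗ₜ h) ⊗ₜ (q ⊗ₜ g)) =
    ∑ i ∈ (ℛ k h).index, ∑ j ∈ (ℛ k q).index,
      toDual k H ((ℛ k q).left j) ((ℛ k h).left i) •
        ((p * (ℛ k q).right j) ⊗ₜ[k] ((ℛ k h).right i * g)) := by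
  have := (((ℛ k p).tmul (ℛ k h)).tmul ((ℛ k q).tmul (ℛ k g))).convMul_apply
    (scal (DualCop k H ⊗[k] H) (sigma k H))
      (toConv (LinearMap.mul' k (DualCop k H ⊗[k] H)))
  rw [this]
  conv_rhs => rw [← sum_counit_toDual p, ← sum_counit_smul (R := k) (ℛ k g)]
  simp [scal, Finset.sum_product, ← Algebra.smul_def, Finset.sum_mul, Finset.mul_sum,
    TensorProduct.sum_tmul, TensorProduct.tmul_sum]
  rw [Finset.sum_comm]
  refine Finset.sum_congr rfl fun i _ => ?_
  rw [Finset.sum_comm]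
  refine Finset.sum_congr rfl fun j _ => ?_
  rw [Finset.sum_comm, Finset.smul_sum]
  refine Finset.sum_congr rfl fun l _ => ?_
  rw [Finset.smul_sum, Finset.smul_sum]
  refine Finset.sum_congr rfl fun m _ => ?_
  simp only [← TensorProduct.smul_tmul', smul_smul]
  congr 1
  ring

lemma sigma_cocycle : sigma k H ∘ₗ (scal _ (sigma k H) * toConv (LinearMap.mul' k _)).ofConv.rTensor _ =
      (sigma k H ∘ₗ (scal _ (sigma k H) * toConv (LinearMap.mul' k _)).ofConv.lTensor _) ∘ₗ
        (TensorProduct.assoc k _ _ _).toLinearMap := by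
  ext p h q g r f
  change sigma k H ((scal _ (sigma k H) * toConv (LinearMap.mul' k _)).ofConv
      ((p ⊗ₜ h) ⊗ₜ (q ⊗ₜ g)) ⊗ₜ (r ⊗ₜ f)) =
    sigma k H ((p ⊗ₜ h) ⊗ₜ (scal _ (sigma k H) * toConv (LinearMap.mul' k _)).ofConv
      ((q ⊗ₜ g) ⊗ₜ (r ⊗ₜ f)))
  rw [scal_sigma_mul, scal_sigma_mul]
  simp [TensorProduct.sum_tmul, TensorProduct.tmul_sum, ← TensorProduct.smul_tmul',
    Algebra.TensorProduct.one_def, toDual_mul _ _ h, toDual_mul' _ _ (1 : H)]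
  trans ∑ i ∈ (ℛ k h).index, toDual k H q ((ℛ k h).left i) *
    (toDual k H p 1 * toDual k H r ((ℛ k h).right i * g) * counit (R := k) f)
  · refine Finset.sum_congr rfl fun i _ => ?_
    conv_rhs => rw [← one_mul ((ℛ k h).left i), ← sum_pair_comul, Finset.sum_mul]
    exact Finset.sum_congr rfl fun j _ => by ring
  · simp only [Finset.mul_sum, Finset.sum_mul]
    simp_rw [Finset.sum_comm (t := (ℛ k h).index)]
    refine Finset.sum_congr rfl fun i _ => ?_
    conv_lhs => rw [← sum_counit_smul_left (k := k) g]
    simp only [Finset.mul_sum, Finset.sum_mul, map_sum, mul_smul_comm, map_smul, smul_eq_mul]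
    refine Finset.sum_congr rfl fun j _ => ?_
    rw [← sum_pair_comul]
    simp only [Finset.mul_sum, Finset.sum_mul]
    exact Finset.sum_congr rfl fun l _ => by ring

end Pairing

section Factor
variable {k A B C D : Type*} [CommRing k] [Ring A] [HopfAlgebra k A] [Ring B] [HopfAlgebra k B]
  [Ring D] [Bialgebra k D] [AddCommGroup C] [Module k C] [Coalgebra k C]

lemma conv_one_pullback (f : A →ₐ[k] D) (π : C →ₗc[k] A)
    (u v : A →ₗ[k] A) (h : toConv u * toConv v = 1) :
    toConv (f.toLinearMap ∘ₗ u ∘ₗ π.toLinearMap) *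
      toConv (f.toLinearMap ∘ₗ v ∘ₗ π.toLinearMap) = 1 := by
  have h1 := LinearMap.algHom_comp_convMul_distrib f (toConv u) (toConv v)
  have h2 := conv_comp (toConv (f.toLinearMap ∘ₗ u)) (toConv (f.toLinearMap ∘ₗ v)) π
  refine h2.symm.trans ?_
  have h3 := congr(toConv ($h1 ∘ₗ π.toLinearMap))
  refine h3.symm.trans ?_
  rw [h]
  apply WithConv.ext
  ext c
  simp [LinearMap.convOne_def]

/-- The antipode of a bialgebra `D` for which `id = (f ∘ π) * (g ∘ ρ)` in the convolution algebra,
with algebra maps `f`, `g` from Hopf algebras and coalgebra maps `π`, `ρ` to them: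
it is `(g ∘ S ∘ ρ) * (f ∘ S ∘ π)`. -/
noncomputable abbrev hopfOfFactor (f : A →ₐ[k] D) (g : B →ₐ[k] D) (π : D →ₗc[k] A)
    (ρ : D →ₗc[k] B) (h : toConv (f.toLinearMap ∘ₗ π.toLinearMap) *
      toConv (g.toLinearMap ∘ₗ ρ.toLinearMap) = toConv LinearMap.id) : HopfAlgebra k D :=
  HopfAlgebra.ofConvInverse
    (toConv (g.toLinearMap ∘ₗ antipode k ∘ₗ ρ.toLinearMap) *
      toConv (f.toLinearMap ∘ₗ antipode k ∘ₗ π.toLinearMap)).ofConv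
    (by
      have h1 := conv_one_pullback f π _ _ LinearMap.antipode_mul_id
      have h2 := conv_one_pullback g ρ _ _ LinearMap.antipode_mul_id
      rw [LinearMap.id_comp] at h1 h2
      rw [← h, toConv_ofConv, mul_assoc, ← mul_assoc (toConv (f.toLinearMap ∘ₗ _)), h1, one_mul, h2])
    (by
      have h1 := conv_one_pullback f π _ _ LinearMap.id_mul_antipode
      have h2 := conv_one_pullback g ρ _ _ LinearMap.id_mul_antipode
      rw [LinearMap.id_comp] at h1 h2
      rw [← h, toConv_ofConv, mul_assoc, ← mul_assoc (toConv (g.toLinearMap ∘ₗ _)), h2, one_mul, h1])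

end Factor

section Double
variable (k H : Type*) [Field k] [Ring H] [HopfAlgebra k H] [FiniteDimensional k H]

/-- The cocycle on the tensor product Hopf algebra `H^{*cop} ⊗ H` whose twist is the
Drinfeld double. -/
noncomputable def doubleCocycle : Cocycle k (DualCop k H ⊗[k] H) where
  σ := sigma k H
  σ' := sigmaInv k H
  mul_inv := sigma_mul_sigmaInv
  inv_mul := sigmaInv_mul_sigma
  one_left b := by
    induction b with
    | zero => simp
    | add x y hx hy => rw [TensorProduct.tmul_add, map_add, hx, hy, map_add]
    | tmul q g => simp [Algebra.TensorProduct.one_def, mul_comm]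
  one_right b := by
    induction b with
    | zero => simp
    | add x y hx hy => rw [TensorProduct.add_tmul, map_add, hx, hy, map_add]
    | tmul q g => simp [Algebra.TensorProduct.one_def, mul_comm]
  cocycle := sigma_cocycle

/-- The Drinfeld double `D(H)`: the space `H^{*cop} ⊗ H` with the tensor product coalgebra
structure and the multiplication
`(p ⊗ h) (q ⊗ g) = ∑ p · q(S⁻¹(h₃) ? h₁) ⊗ h₂ g`, which is obtained by twisting the tensor product
algebra structure by the cocycle `(p ⊗ h) ⊗ (q ⊗ g) ↦ p(1) q(h) ε(g)`. -/
abbrev DrinfeldDouble : Type _ := CocycleTwist (doubleCocycle k H)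

namespace DrinfeldDouble

instance : FiniteDimensional k (DrinfeldDouble k H) :=
  inferInstanceAs (FiniteDimensional k (DualCop k H ⊗[k] H))

/-- `p ↦ p ⊗ 1` as a map of coalgebras. -/
noncomputable def coalgInl : DualCop k H →ₗc[k] DualCop k H ⊗[k] H :=
  (Coalgebra.TensorProduct.map (CoalgHom.id k (DualCop k H))
    (Bialgebra.unitBialgHom k H : k →ₗc[k] H)).comp
    ((Coalgebra.TensorProduct.rid k k (DualCop k H)).symm : DualCop k H →ₗc[k] _)

/-- `h ↦ 1 ⊗ h` as a map of coalgebras. -/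
noncomputable def coalgInr : H →ₗc[k] DualCop k H ⊗[k] H :=
  (Coalgebra.TensorProduct.map (Bialgebra.unitBialgHom k (DualCop k H) : k →ₗc[k] _)
    (CoalgHom.id k H)).comp
    ((Coalgebra.TensorProduct.lid k H).symm : H →ₗc[k] _)

variable {k H}

@[simp] lemma coalgInl_apply (p : DualCop k H) : coalgInl k H p = p ⊗ₜ 1 := by
  simp [coalgInl]

@[simp] lemma coalgInr_apply (h : H) : coalgInr k H h = 1 ⊗ₜ h := by
  simp [coalgInr]

lemma twMul_one_tmul (p q : DualCop k H) (g : H) :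
    twMul (sigma k H) (sigmaInv k H) ((p ⊗ₜ 1) ⊗ₜ (q ⊗ₜ g)) = (p * q) ⊗ₜ g := by
  have := (doubleCocycle k H).twMul_of_trivial
    (Coalgebra.TensorProduct.map (coalgInl k H) (CoalgHom.id k _))
    (by ext p q g; simp [doubleCocycle, mul_comm, mul_left_comm]) (p ⊗ₜ (q ⊗ₜ g))
  simp only [Coalgebra.TensorProduct.map_tmul, coalgInl_apply, CoalgHom.coe_id, id_eq,
    LinearMap.mul'_apply, Algebra.TensorProduct.tmul_mul_tmul, one_mul] at this
  exact this

lemma twMul_tmul_one (p : DualCop k H) (h g : H) :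
    twMul (sigma k H) (sigmaInv k H) ((p ⊗ₜ h) ⊗ₜ (1 ⊗ₜ g)) = p ⊗ₜ (h * g) := by
  have := (doubleCocycle k H).twMul_of_trivial
    (Coalgebra.TensorProduct.map (CoalgHom.id k _) (coalgInr k H))
    (by ext p h g; simp [doubleCocycle, mul_comm, mul_left_comm]) ((p ⊗ₜ h) ⊗ₜ g)
  simp only [Coalgebra.TensorProduct.map_tmul, coalgInr_apply, CoalgHom.coe_id, id_eq,
    LinearMap.mul'_apply, Algebra.TensorProduct.tmul_mul_tmul, mul_one] at this
  exact this

variable (k H) in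
/-- The inclusion `p ↦ p ⊗ 1` of `H^{*cop}` in the Drinfeld double. -/
noncomputable def inl : DualCop k H →ₐ[k] DrinfeldDouble k H :=
  AlgHom.ofLinearMap ((CocycleTwist.of (doubleCocycle k H)).toLinearMap ∘ₗ
      (coalgInl k H).toLinearMap)
    (congrArg (CocycleTwist.of (doubleCocycle k H)) (coalgInl_apply (k := k) (H := H) 1)) (by
    intro p q
    have h := twMul_one_tmul p q (1 : H)
    rw [← coalgInl_apply, ← coalgInl_apply, ← coalgInl_apply] at h
    exact h.symm)

variable (k H) in
/-- The inclusion `h ↦ 1 ⊗ h` of `H` in the Drinfeld double. -/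
noncomputable def inr : H →ₐ[k] DrinfeldDouble k H :=
  AlgHom.ofLinearMap ((CocycleTwist.of (doubleCocycle k H)).toLinearMap ∘ₗ
      (coalgInr k H).toLinearMap)
    (congrArg (CocycleTwist.of (doubleCocycle k H)) (coalgInr_apply (k := k) (H := H) 1)) (by
    intro p q
    have h := twMul_tmul_one (1 : DualCop k H) p q
    rw [← coalgInr_apply, ← coalgInr_apply, ← coalgInr_apply] at h
    exact h.symm)

lemma factor_aux : TensorProduct.map ((coalgInl k H).toLinearMap ∘ₗ (projL k H).toLinearMap)
      ((coalgInr k H).toLinearMap ∘ₗ (projR k H).toLinearMap) ∘ₗ comul =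
    TensorProduct.map (coalgInl k H).toLinearMap (coalgInr k H).toLinearMap := by
  apply TensorProduct.ext'
  intro p h
  have := ((ℛ k p).tmul (ℛ k h)).eq
  rw [LinearMap.comp_apply, ← this]
  have hp := sum_counit_smul_left (k := k) p
  have hh := sum_counit_smul (R := k) (ℛ k h)
  conv_rhs => rw [← hp, ← hh]
  simp [Finset.sum_product, TensorProduct.sum_tmul, TensorProduct.tmul_sum,
    ← TensorProduct.smul_tmul', smul_smul]
  rw [Finset.sum_comm]
  refine Finset.sum_congr rfl fun i _ => ?_
  rw [Finset.smul_sum]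
  exact Finset.sum_congr rfl fun j _ => by rw [smul_smul, mul_comm]

variable (k H) in
lemma factor : toConv ((inl k H).toLinearMap ∘ₗ
      (show DrinfeldDouble k H →ₗc[k] DualCop k H from projL k H).toLinearMap) *
      toConv ((inr k H).toLinearMap ∘ₗ
        (show DrinfeldDouble k H →ₗc[k] H from projR k H).toLinearMap) = toConv LinearMap.id := by
  have h : twMul (sigma k H) (sigmaInv k H) ∘ₗ
      (TensorProduct.map ((coalgInl k H).toLinearMap ∘ₗ (projL k H).toLinearMap)
      ((coalgInr k H).toLinearMap ∘ₗ (projR k H).toLinearMap) ∘ₗ comul) = LinearMap.id := by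
    rw [factor_aux]
    apply TensorProduct.ext'
    intro p h
    have := twMul_one_tmul p (1 : DualCop k H) h
    rw [mul_one] at this
    rw [LinearMap.comp_apply, TensorProduct.map_tmul]
    exact (congrArg₂ (fun a b => twMul (sigma k H) (sigmaInv k H) (a ⊗ₜ b)) (coalgInl_apply p)
      (coalgInr_apply h)).trans this
  have e : LinearMap.mul' k (DrinfeldDouble k H) = twMul (sigma k H) (sigmaInv k H) :=
    TensorProduct.ext' fun _ _ => rfl
  rw [LinearMap.convMul_def]
  apply WithConv.ext
  rw [e]
  exact h

noncomputable instance : HopfAlgebra k (DrinfeldDouble k H) :=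
  hopfOfFactor (inl k H) (inr k H) _ _ (factor k H)

lemma dual_aux (q : DualCop k H) (x y : H) :
    ∑ a ∈ (ℛ k q).index, toDual k H ((ℛ k q).right a) y •
      ∑ b ∈ (ℛ k ((ℛ k q).left a)).index, toDual k H ((ℛ k ((ℛ k q).left a)).left b) x •
        (ℛ k ((ℛ k q).left a)).right b =
    (toDual k H).symm (toDual k H q ∘ₗ LinearMap.mulLeft k y ∘ₗ LinearMap.mulRight k x) := by
  apply (toDual k H).injective
  ext z
  simp [sum_pair_comul, mul_comm (toDual k H _ y)]

/-- The product of the Drinfeld double: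
`(p ⊗ h) (q ⊗ g) = ∑ p · q(S⁻¹(h₃) ? h₁) ⊗ h₂ g`. -/
lemma tmul_mul_tmul (p q : DualCop k H) (h g : H) :
    CocycleTwist.of (doubleCocycle k H) (p ⊗ₜ h) * CocycleTwist.of (doubleCocycle k H) (q ⊗ₜ g) =
      CocycleTwist.of (doubleCocycle k H)
        (∑ i ∈ (ℛ k h).index, ∑ j ∈ (ℛ k ((ℛ k h).left i)).index,
          (p * (toDual k H).symm (toDual k H q ∘ₗ
            LinearMap.mulLeft k (antipodeInv k H ((ℛ k h).right i)) ∘ₗ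
            LinearMap.mulRight k ((ℛ k ((ℛ k h).left i)).left j))) ⊗ₜ
          ((ℛ k ((ℛ k h).left i)).right j * g)) := by
  rw [CocycleTwist.of_mul]
  congr 1
  have := (((ℛ k p).tmul (ℛ k h)).tmul ((ℛ k q).tmul (ℛ k g))).convMul_apply
    (scal (DualCop k H ⊗[k] H) (sigma k H) *
      toConv (LinearMap.mul' k (DualCop k H ⊗[k] H))) (scal (DualCop k H ⊗[k] H) (sigmaInv k H))
  refine this.trans ?_
  clear this
  have hu := scal_sigma_mul (k := k) (H := H)
  generalize (scal (DualCop k H ⊗[k] H) (sigma k H) *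
      toConv (LinearMap.mul' k (DualCop k H ⊗[k] H))) = u at hu ⊢
  have h1 : ∀ h' q', u.ofConv ((p ⊗ₜ h') ⊗ₜ (q' ⊗ₜ g)) =
      ∑ x ∈ (ℛ k p).index, ∑ y ∈ (ℛ k g).index,
        (toDual k H ((ℛ k p).right x) 1 * counit (R := k) ((ℛ k g).right y)) •
          u.ofConv (((ℛ k p).left x ⊗ₜ h') ⊗ₜ (q' ⊗ₜ (ℛ k g).left y)) := by
    intro h' q'
    have hp := sum_counit_smul_left (k := k) p
    have hg := sum_counit_smul_left (k := k) g
    conv_lhs => rw [← hp, ← hg]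
    simp only [TensorProduct.sum_tmul, TensorProduct.tmul_sum, map_sum,
      ← TensorProduct.smul_tmul', TensorProduct.tmul_smul, map_smul, smul_smul, Finset.smul_sum]
    rw [Finset.sum_comm]
    exact Finset.sum_congr rfl fun _ _ => Finset.sum_congr rfl fun _ _ => by rw [mul_comm]; rfl
  have h2 : ∑ i ∈ (ℛ k h).index, ∑ a ∈ (ℛ k q).index,
      toDual k H ((ℛ k q).right a) (antipodeInv k H ((ℛ k h).right i)) •
        u.ofConv ((p ⊗ₜ (ℛ k h).left i) ⊗ₜ ((ℛ k q).left a ⊗ₜ g)) =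
      ∑ i ∈ (ℛ k h).index, ∑ j ∈ (ℛ k ((ℛ k h).left i)).index,
          (p * (toDual k H).symm (toDual k H q ∘ₗ
            LinearMap.mulLeft k (antipodeInv k H ((ℛ k h).right i)) ∘ₗ
            LinearMap.mulRight k ((ℛ k ((ℛ k h).left i)).left j))) ⊗ₜ
          ((ℛ k ((ℛ k h).left i)).right j * g) := by
    simp only [← dual_aux, hu, Finset.mul_sum, TensorProduct.sum_tmul, mul_smul_comm,
      Finset.smul_sum, ← TensorProduct.smul_tmul', smul_smul]
    refine Finset.sum_congr rfl fun i _ => ?_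
    rw [Finset.sum_comm]
  rw [← h2]
  simp only [h1, Coalgebra.Repr.tmul]
  simp only [Finset.sum_product, scal, ofConv_toConv, LinearMap.comp_apply,
    sigmaInv_tmul, Algebra.linearMap_apply, ← Algebra.commutes, ← Algebra.smul_def]
  rw [Finset.sum_comm]
  refine Finset.sum_congr rfl fun i _ => ?_
  rw [Finset.sum_comm]
  refine Finset.sum_congr rfl fun a _ => ?_
  rw [Finset.smul_sum]
  refine Finset.sum_congr rfl fun x _ => ?_
  rw [Finset.smul_sum]
  refine Finset.sum_congr rfl fun y _ => ?_
  rw [smul_smul]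
  congr 1
  ring

end DrinfeldDouble
end Double

section Exponent
variable (k H : Type*) [Field k] [Ring H] [HopfAlgebra k H]

/-- The identification `H^{⊗ n} ⊗ H ≅ H^{⊗ (n + 1)}`. -/
noncomputable def snocTensor (n : ℕ) : (⨂[k]^n H) ⊗[k] H ≃ₗ[k] ⨂[k]^(n + 1) H :=
  (LinearEquiv.lTensor _ (PiTensorProduct.subsingletonEquiv (R := k) (s := fun _ : Fin 1 => H) (0 : Fin 1)).symm).trans
    TensorPower.mulEquiv

/-- The iterated comultiplication `Δ_n : H → H^{⊗ n}`, with `Δ_{n + 1} = (Δ_n ⊗ I) ∘ Δ`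
(and `Δ_0 = ε`, so that `Δ_1 = I`). -/
noncomputable def iterComul : (n : ℕ) → H →ₗ[k] ⨂[k]^n H
  | 0 => (PiTensorProduct.isEmptyEquiv (Fin 0)).symm.toLinearMap ∘ₗ counit
  | n + 1 => (snocTensor k H n).toLinearMap ∘ₗ (iterComul n).rTensor H ∘ₗ comul

/-- The iterated multiplication `m_n : H^{⊗ n} → H`, `x₁ ⊗ ⋯ ⊗ x_n ↦ x₁ ⋯ x_n`. -/
noncomputable def iterMul (n : ℕ) : (⨂[k]^n H) →ₗ[k] H :=
  PiTensorProduct.lift (MultilinearMap.mkPiAlgebraFin k n H)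

variable {k H} in
lemma snocTensor_tprod (n : ℕ) (a : Fin n → H) (x : H) :
    snocTensor k H n (PiTensorProduct.tprod k a ⊗ₜ x) =
      PiTensorProduct.tprod k (Fin.snoc (α := fun _ => H) a x) := by
  have h : (PiTensorProduct.subsingletonEquiv (R := k) (s := fun _ : Fin 1 => H)
      (0 : Fin 1)).symm x = PiTensorProduct.tprod k fun _ => x := by
    rw [LinearEquiv.symm_apply_eq, PiTensorProduct.subsingletonEquiv_apply_tprod]
  rw [snocTensor, LinearEquiv.trans_apply, LinearEquiv.lTensor_tmul, h, ← TensorPower.gMul_def,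
    TensorPower.tprod_mul_tprod, Fin.append_right_eq_snoc]

variable [FiniteDimensional k H]

/-- The map `m_n ∘ (I ⊗ S⁻² ⊗ ⋯ ⊗ S^{-2n+2}) ∘ Δ_n : H → H`. -/
noncomputable def twistedPower (n : ℕ) : H →ₗ[k] H :=
  iterMul k H n ∘ₗ PiTensorProduct.map (fun i : Fin n => antipodeInv k H ^ (2 * (i : ℕ))) ∘ₗ
    iterComul k H n

/-- The exponent of a finite-dimensional Hopf algebra: the smallest positive integer `n` such that
`m_n ∘ (I ⊗ S⁻² ⊗ ⋯ ⊗ S^{-2n+2}) ∘ Δ_n = ε · 1`, and `∞` if there is none. -/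
noncomputable def exponent : ℕ∞ :=
  ⨅ n ∈ {n : ℕ | 0 < n ∧ twistedPower k H n = Algebra.linearMap k H ∘ₗ counit}, (n : ℕ∞)

variable {k H}

lemma iterMul_map_snoc (n : ℕ) (t : ⨂[k]^n H) (x : H) :
    iterMul k H (n + 1) (PiTensorProduct.map
      (fun i : Fin (n + 1) => antipodeInv k H ^ (2 * (i : ℕ))) (snocTensor k H n (t ⊗ₜ x))) =
    iterMul k H n (PiTensorProduct.map (fun i : Fin n => antipodeInv k H ^ (2 * (i : ℕ))) t) *
      (antipodeInv k H ^ (2 * n)) x := by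
  induction t using PiTensorProduct.induction_on with
  | smul_tprod r a =>
    rw [← TensorProduct.smul_tmul']
    simp only [map_smul, snocTensor_tprod, PiTensorProduct.map_tprod, iterMul,
      PiTensorProduct.lift.tprod, MultilinearMap.mkPiAlgebraFin_apply, smul_mul_assoc,
      List.ofFn_succ', List.concat_eq_append, List.prod_append, Fin.snoc_castSucc, Fin.snoc_last,
      Fin.val_castSucc, Fin.val_last, List.prod_singleton]
  | add s t hs ht => simp [TensorProduct.add_tmul, hs, ht, add_mul]

lemma twistedPower_succ (n : ℕ) : twistedPower k H (n + 1) =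
    LinearMap.mul' k H ∘ₗ TensorProduct.map (twistedPower k H n) (antipodeInv k H ^ (2 * n)) ∘ₗ
      comul := by
  have : ∀ t : H ⊗[k] H, iterMul k H (n + 1) (PiTensorProduct.map
      (fun i : Fin (n + 1) => antipodeInv k H ^ (2 * (i : ℕ)))
        (snocTensor k H n ((iterComul k H n).rTensor H t))) =
      LinearMap.mul' k H (TensorProduct.map (twistedPower k H n)
        (antipodeInv k H ^ (2 * n)) t) := by
    intro t
    induction t with
    | zero => simp
    | add s t hs ht => simp only [map_add, hs, ht]
    | tmul x y => 
      rw [LinearMap.rTensor_tmul, iterMul_map_snoc]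
      rfl
  exact LinearMap.ext fun x => this (comul x)

lemma twistedPower_zero : twistedPower k H 0 = Algebra.linearMap k H ∘ₗ counit := by
  ext x
  have h : (PiTensorProduct.isEmptyEquiv (R := k) (s := fun _ : Fin 0 => H) (Fin 0)).symm
      (counit x) = counit (R := k) x • PiTensorProduct.tprod k isEmptyElim := rfl
  simp only [twistedPower, iterComul, LinearMap.comp_apply, LinearEquiv.coe_coe, h, map_smul,
    PiTensorProduct.map_tprod, iterMul, PiTensorProduct.lift.tprod,
    MultilinearMap.mkPiAlgebraFin_apply, Algebra.linearMap_apply, Algebra.algebraMap_eq_smul_one,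
    List.ofFn_zero, List.prod_nil]

end Exponent

end HopfExponent

/-!
The exponent is detected by the Drinfeld element. Write `Tₙ` for the twisted power map of a Hopf
algebra, `D` for the double of `H`, and `eᵢ`, `eⁱ` for dual bases of `H` and `H^*`.

Let `W = ∑ aᵢ ⊗ bᵢ` in `A ⊗ E` satisfy `(Δ ⊗ id) W = W₂₃ W₁₃`, let `f : A → E` be a map of algebras,
and suppose that `U = ∑ bᵢ f(aᵢ)` satisfies `U f(x) = f(S² x) U`. Then `∑ bᵢ f(Tₙ(aᵢ)) = Uⁿ` for
all `n` (`IsAntiCanonical.sum_twistedPower`). This is used twice.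

* For `A = H`, `E = D` and `W = ∑ eᵢ ⊗ S(eⁱ)`, the element `U` is the Drinfeld element
  `u = ∑ S(eⁱ) eᵢ`, which implements `S²` since `∑ eᵢ ⊗ eⁱ` intertwines `Δ` and `Δ^{op}`
  (`rMatrix_mul_comul`, `sum_antipode_mul_mul`). Hence `uⁿ = 1` if `Tₙ` is trivial on `H`.
* For `A = D`, `E = D ⊗ D`, `f = Δ` and `W = ∑ eᵢ eʲ ⊗ (S(eⁱ) ⊗ S²(eⱼ))`, the element `U` is
  `u ⊗ S(u⁻¹)` (`IsAntiCanonical.sum_tmul_mul_comul`). Moreover `T ↦ ∑ (S(eⁱ) ⊗ S²(eⱼ)) Δ(T(eᵢ eʲ))`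
  is injective on the endomorphisms of `D` (`contraction_injective`), so `uⁿ = 1` forces `Tₙ` to
  be trivial on `D`. (Behind this is the isomorphism of algebras between the double of the
  factorizable Hopf algebra `D` and `D ⊗ D`.)

Conversely, `H` is a Hopf subalgebra of `D`, so if `Tₙ` is trivial on `D`, it is trivial on `H`.
-/

namespace HopfExponent
open scoped TensorProduct
open Coalgebra HopfAlgebra WithConv DualCop DrinfeldDouble

/-! ### Antipodes and maps of bialgebras -/

section AntipodeHom
variable {k A B : Type*} [CommRing k] [Ring A] [HopfAlgebra k A] [Ring B] [HopfAlgebra k B]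

lemma antipode_bialgHom (f : A →ₐc[k] B) (x : A) : antipode k (f x) = f (antipode k x) := by
  have h1 : toConv (antipode k ∘ₗ (f : A →ₗc[k] B).toLinearMap) *
      toConv (f : A →ₗc[k] B).toLinearMap = 1 := by
    have := conv_comp (toConv (antipode k (A := B))) (toConv LinearMap.id) (f : A →ₗc[k] B)
    rw [LinearMap.antipode_mul_id] at this
    refine Eq.trans this.symm ?_
    ext; simp
  have h2 : toConv (f : A →ₗc[k] B).toLinearMap *
      toConv ((f : A →ₐ[k] B).toLinearMap ∘ₗ antipode k) = 1 := by
    have := LinearMap.algHom_comp_convMul_distrib (f : A →ₐ[k] B) (toConv LinearMap.id)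
      (toConv (antipode k (A := A)))
    rw [LinearMap.id_mul_antipode] at this
    refine Eq.trans (congrArg toConv this.symm) ?_
    ext; exact (f : A →ₐ[k] B).commutes _
  exact LinearMap.congr_fun (congrArg ofConv (left_inv_eq_right_inv h1 h2)) x

lemma antipode_pow (x : A) (n : ℕ) : antipode k (x ^ n) = antipode k x ^ n := by
  induction n with
  | zero => simp
  | succ n ih => rw [pow_succ, antipode_mul_antidistrib, ih, pow_succ']

/-- The antipode reverses the comultiplication: `τ (S ⊗ S) Δ` is a left convolution inverse of
`Δ = (x ↦ x ⊗ 1) * (x ↦ 1 ⊗ x)`, and `Δ ∘ S` is a right one. -/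
lemma comul_antipode (x : A) : comul (R := k) (antipode k x) =
    TensorProduct.comm k A A (TensorProduct.map (antipode k) (antipode k) (comul x)) := by
  let iL : A →ₐ[k] A ⊗[k] A := Algebra.TensorProduct.includeLeft
  let iR : A →ₐ[k] A ⊗[k] A := Algebra.TensorProduct.includeRight
  have inv : ∀ i : A →ₐ[k] A ⊗[k] A, toConv (i.toLinearMap ∘ₗ antipode k) *
      toConv i.toLinearMap = 1 := fun i => by
    have := LinearMap.algHom_comp_convMul_distrib i (toConv (antipode k (A := A)))
      (toConv LinearMap.id)
    rw [LinearMap.antipode_mul_id] at this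
    refine Eq.trans (congrArg toConv this.symm) ?_
    ext; simp
  have hΔ : toConv (comul : A →ₗ[k] A ⊗[k] A) = toConv iL.toLinearMap * toConv iR.toLinearMap := by
    have := map_comp_comul (LinearMap.id (R := k) (M := A)) LinearMap.id
    rw [TensorProduct.map_id] at this
    exact this
  have hS : toConv ((TensorProduct.comm k A A).toLinearMap ∘ₗ
      TensorProduct.map (antipode k) (antipode k) ∘ₗ comul) =
      toConv (iR.toLinearMap ∘ₗ antipode k) * toConv (iL.toLinearMap ∘ₗ antipode k) := by
    rw [LinearMap.convMul_def, ← LinearMap.comp_assoc, ← LinearMap.comp_assoc]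
    congr 2
    ext; simp [iL, iR]
  have h1 : toConv ((TensorProduct.comm k A A).toLinearMap ∘ₗ
      TensorProduct.map (antipode k) (antipode k) ∘ₗ comul) *
      toConv (comul : A →ₗ[k] A ⊗[k] A) = 1 := by
    rw [hS, hΔ, mul_assoc, ← mul_assoc (toConv (iL.toLinearMap ∘ₗ _)), inv, one_mul, inv]
  exact (LinearMap.congr_fun (congrArg ofConv
    (left_inv_eq_right_inv h1 LinearMap.comul_right_inv)) x).symm

lemma comul_antipode_antipode (x : A) : comul (R := k) (antipode k (antipode k x)) =
    TensorProduct.map (antipode k ∘ₗ antipode k) (antipode k ∘ₗ antipode k) (comul x) := by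
  rw [comul_antipode, comul_antipode]
  generalize (comul x : A ⊗[k] A) = t
  induction t with
  | zero => simp
  | add s t hs ht => simp only [map_add, hs, ht]
  | tmul a b => simp

end AntipodeHom

section Power
variable {k A B : Type*} [Field k] [Ring A] [HopfAlgebra k A] [FiniteDimensional k A]
  [Ring B] [HopfAlgebra k B] [FiniteDimensional k B]

lemma antipodeInv_bialgHom (f : A →ₐc[k] B) (x : A) :
    antipodeInv k B (f x) = f (antipodeInv k A x) := by
  apply (antipode_bijective (k := k)).1
  rw [antipode_antipodeInv, antipode_bialgHom, antipode_antipodeInv]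

/-- Maps of bialgebras commute with the twisted power maps. -/
lemma twistedPower_bialgHom (f : A →ₐc[k] B) (n : ℕ) (x : A) :
    twistedPower k B n (f x) = f (twistedPower k A n x) := by
  induction n generalizing x with
  | zero =>
    simp only [twistedPower_zero, LinearMap.comp_apply, CoalgHomClass.counit_comp_apply]
    exact ((f : A →ₐ[k] B).commutes _).symm
  | succ n ih =>
    have hp : ∀ (m : ℕ) (y : A), (antipodeInv k B ^ m) (f y) = f ((antipodeInv k A ^ m) y) := by
      intro m
      induction m with
      | zero => intro y; rfl
      | succ m ihm => intro y; rw [pow_succ, pow_succ, Module.End.mul_apply,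
          Module.End.mul_apply, antipodeInv_bialgHom, ihm]
    have hc : comul (R := k) (f x) = TensorProduct.map (f : A →ₗc[k] B).toLinearMap
        (f : A →ₗc[k] B).toLinearMap (comul x) := (CoalgHomClass.map_comp_comul_apply f x).symm
    rw [twistedPower_succ, twistedPower_succ]
    simp only [LinearMap.comp_apply, hc]
    generalize (comul x : A ⊗[k] A) = t
    induction t with
    | zero => simp
    | add s t hs ht => simp only [map_add, hs, ht]
    | tmul a b => simp [ih, hp]

end Power

/-! ### Elements implementing the square of the antipode -/

section AntiCanonical
variable {k A E ι : Type*} [Field k] [Ring A] [HopfAlgebra k A] [Ring E] [Algebra k E] [Fintype ι]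

/-- If `R = ∑ rᵢ ⊗ sᵢ` satisfies `R Δ(x) = Δ^{op}(x) R`, then the element `∑ S(sᵢ) rᵢ`
implements `S²`: apply `a ⊗ b ⊗ c ↦ S²(c) S(b) a` to `R Δ(x₁) ⊗ x₂ = Δ^{op}(x₁) R ⊗ x₂`. -/
theorem sum_antipode_mul_mul {r s : ι → A} (h : ∀ x : A, (∑ i, r i ⊗ₜ[k] s i) * comul x =
      TensorProduct.comm k A A (comul x) * ∑ i, r i ⊗ₜ[k] s i) (x : A) :
    (∑ i, antipode k (s i) * r i) * x =
      antipode k (antipode k x) * ∑ i, antipode k (s i) * r i := by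
  let F : A ⊗[k] (A ⊗[k] A) →ₗ[k] A := LinearMap.mul' k A ∘ₗ (TensorProduct.comm k A A).toLinearMap
    ∘ₗ TensorProduct.map (LinearMap.id) (LinearMap.mul' k A ∘ₗ (TensorProduct.comm k A A).toLinearMap
    ∘ₗ TensorProduct.map (antipode k) (antipode k ∘ₗ antipode k))
  have hF : ∀ a b c : A, F (a ⊗ₜ (b ⊗ₜ c)) = antipode k (antipode k c) * antipode k b * a := by
    intro a b c; simp [F]
  have key : ∀ (y c : A), ∑ i, ∑ j ∈ (ℛ k y).index,
      F ((r i * (ℛ k y).left j) ⊗ₜ ((s i * (ℛ k y).right j) ⊗ₜ c)) =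
      ∑ i, ∑ j ∈ (ℛ k y).index,
      F (((ℛ k y).right j * r i) ⊗ₜ (((ℛ k y).left j * s i) ⊗ₜ c)) := by
    intro y c
    have := congrArg (fun t => F (TensorProduct.assoc k A A A (t ⊗ₜ c))) (h y)
    rw [← (ℛ k y).eq] at this
    simpa [Finset.sum_mul_sum, TensorProduct.sum_tmul, Finset.sum_comm (s := (ℛ k y).index)]
      using this
  have key2 := Finset.sum_congr (rfl : (ℛ k x).index = _)
    fun l _ => key ((ℛ k x).left l) ((ℛ k x).right l)
  have assoc1 := fun i => sum_coassoc (F ∘ₗ TensorProduct.map (LinearMap.mulLeft k (r i))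
    ((LinearMap.mulLeft k (s i)).rTensor A)) x
  simp only [LinearMap.comp_apply, TensorProduct.map_tmul, LinearMap.mulLeft_apply,
    LinearMap.rTensor_tmul] at assoc1
  have hS : ∀ y : A, ∑ j ∈ (ℛ k y).index, antipode k (antipode k ((ℛ k y).right j)) *
      antipode k ((ℛ k y).left j) = counit (R := k) y • 1 := by
    intro y
    simp_rw [← antipode_mul_antidistrib, ← map_sum, sum_mul_antipode_eq_smul]
    simp
  have lhs : ∀ i, ∑ l ∈ (ℛ k x).index, ∑ j ∈ (ℛ k ((ℛ k x).left l)).index,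
      F ((r i * (ℛ k ((ℛ k x).left l)).left j) ⊗ₜ
        ((s i * (ℛ k ((ℛ k x).left l)).right j) ⊗ₜ (ℛ k x).right l)) =
      antipode k (s i) * r i * x := by
    intro i
    rw [assoc1]
    simp only [hF, antipode_mul_antidistrib (s i), ← mul_assoc]
    simp only [← Finset.sum_mul, hS]
    conv_rhs => rw [← sum_counit_smul_left (k := k) x]
    simp [Finset.mul_sum, mul_assoc]
  have rhs : ∀ i, ∑ l ∈ (ℛ k x).index, ∑ j ∈ (ℛ k ((ℛ k x).left l)).index,
      F (((ℛ k ((ℛ k x).left l)).right j * r i) ⊗ₜ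
        (((ℛ k ((ℛ k x).left l)).left j * s i) ⊗ₜ (ℛ k x).right l)) =
      antipode k (antipode k x) * (antipode k (s i) * r i) := by
    intro i
    simp only [hF, antipode_mul_antidistrib _ (s i), mul_assoc]
    simp only [← mul_assoc (antipode k ((ℛ k _).left _)), ← Finset.mul_sum, ← Finset.sum_mul,
      sum_antipode_mul_eq_smul]
    conv_rhs => rw [← sum_counit_smul (R := k) (ℛ k x)]
    simp [Finset.sum_mul]
  simp only [Finset.sum_comm (s := (ℛ k x).index)] at key2
  rw [Finset.sum_mul, Finset.mul_sum, ← Finset.sum_congr rfl fun i _ => lhs i,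
    ← Finset.sum_congr rfl fun i _ => rhs i]
  simpa only [Finset.sum_comm (t := (Finset.univ : Finset ι))] using key2

/-- The element `W = ∑ aᵢ ⊗ bᵢ` of `A ⊗ E` satisfies `(ε ⊗ id) W = 1` and
`(Δ ⊗ id) W = W₂₃ W₁₃`; equivalently, `p ↦ ∑ p(aᵢ) bᵢ` is an anti-homomorphism of algebras from
the convolution algebra `A^*` to `E`. The element is given by the two families of components. -/
structure IsAntiCanonical (k : Type*) {A E ι : Type*} [Field k] [Ring A] [HopfAlgebra k A]
    [Ring E] [Algebra k E] [Fintype ι] (a : ι → A) (b : ι → E) : Prop where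
  counit_smul : ∑ i, counit (R := k) (a i) • b i = 1
  comul_tmul : ∑ i, (comul (a i) : A ⊗[k] A) ⊗ₜ[k] b i =
    ∑ i, ∑ j, (a i ⊗ₜ[k] a j) ⊗ₜ[k] (b j * b i)

lemma IsAntiCanonical.sum_comul {a : ι → A} {b : ι → E} (h : IsAntiCanonical k a b)
    {X : Type*} [AddCommGroup X] [Module k X] (F : (A ⊗[k] A) ⊗[k] E →ₗ[k] X) :
    ∑ i, F (comul (a i) ⊗ₜ b i) = ∑ i, ∑ j, F ((a i ⊗ₜ a j) ⊗ₜ (b j * b i)) := by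
  simpa using congrArg F h.comul_tmul

variable [FiniteDimensional k A]

/-- The twisted power maps are powers of a single element: if `U = ∑ bᵢ f(aᵢ)` satisfies
`U f(x) = f(S² x) U`, then `∑ bᵢ f(Tₙ(aᵢ)) = Uⁿ`, where `Tₙ` is the twisted power map. Indeed
`Tₙ₊₁(x) = Tₙ(x₁) S⁻²ⁿ(x₂)`, and `Uⁿ f(S⁻²ⁿ x) = f(x) Uⁿ`. -/
theorem IsAntiCanonical.sum_twistedPower {a : ι → A} {b : ι → E} (h : IsAntiCanonical k a b)
    (f : A →ₐ[k] E)
    (hU : ∀ x, (∑ i, b i * f (a i)) * f x =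
      f (antipode k (antipode k x)) * ∑ i, b i * f (a i)) (n : ℕ) :
    ∑ i, b i * f (twistedPower k A n (a i)) = (∑ i, b i * f (a i)) ^ n := by
  set U := ∑ i, b i * f (a i) with hUdef
  induction n with
  | zero =>
    simp only [twistedPower_zero, LinearMap.comp_apply, Algebra.linearMap_apply, AlgHom.commutes,
      mul_algebraMap_eq_smul, pow_zero, h.counit_smul]
  | succ n ih =>
    have hn : ∀ (m : ℕ) (x : A), U ^ m * f ((antipodeInv k A ^ (2 * m)) x) = f x * U ^ m := by
      intro m
      induction m with
      | zero => intro x; simp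
      | succ m ihm =>
        intro x
        have e : (antipodeInv k A ^ (2 * (m + 1))) x =
            (antipodeInv k A ^ (2 * m)) (antipodeInv k A (antipodeInv k A x)) := by
          rw [mul_add, pow_add]; simp [pow_two, Module.End.mul_apply]
        rw [e, pow_succ', mul_assoc, ihm, ← mul_assoc, hU]
        simp [mul_assoc]
    let F : (A ⊗[k] A) ⊗[k] E →ₗ[k] E :=
      LinearMap.mul' k E ∘ₗ (TensorProduct.comm k E E).toLinearMap ∘ₗ
        (f.toLinearMap ∘ₗ LinearMap.mul' k A ∘ₗ
          TensorProduct.map (twistedPower k A n) (antipodeInv k A ^ (2 * n))).rTensor E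
    have hF : ∀ i, b i * f (twistedPower k A (n + 1) (a i)) = F (comul (a i) ⊗ₜ b i) := by
      intro i
      simp [F, twistedPower_succ]
    simp_rw [hF, h.sum_comul F]
    rw [Finset.sum_comm]
    have hj : ∀ j, ∑ i, F ((a i ⊗ₜ a j) ⊗ₜ (b j * b i)) = b j * f (a j) * U ^ n := by
      intro j
      rw [mul_assoc, ← hn, ← ih, Finset.sum_mul, Finset.mul_sum]
      exact Finset.sum_congr rfl fun i _ => by simp [F, mul_assoc]
    simp_rw [hj, ← Finset.sum_mul, pow_succ']
    rfl

end AntiCanonical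

/-- Transport along a map of Hopf algebras and a map of algebras. -/
lemma IsAntiCanonical.map {k A A' E E' ι : Type*} [Field k] [Ring A] [HopfAlgebra k A]
    [Ring A'] [HopfAlgebra k A'] [Ring E] [Algebra k E] [Ring E'] [Algebra k E'] [Fintype ι]
    {a : ι → A} {b : ι → E} (h : IsAntiCanonical k a b) (f : A →ₐc[k] A') (g : E →ₐ[k] E') :
    IsAntiCanonical k (fun i => f (a i)) (fun i => g (b i)) where
  counit_smul := by simpa using congrArg g h.counit_smul
  comul_tmul := by
    have := congrArg (TensorProduct.map (TensorProduct.map (f : A →ₐ[k] A').toLinearMap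
      (f : A →ₐ[k] A').toLinearMap) g.toLinearMap) h.comul_tmul
    simp only [map_sum, TensorProduct.map_tmul, AlgHom.toLinearMap_apply, map_mul] at this
    refine Eq.trans (Finset.sum_congr rfl fun i _ => ?_) this
    rw [← CoalgHomClass.map_comp_comul_apply]
    rfl

/-! ### The tensor square of a Hopf algebra -/

section TensorSquare
variable {k A : Type*} [Field k] [Ring A] [HopfAlgebra k A]
  {ι κ : Type*} [Fintype ι] [Fintype κ]

/-- If `X = ∑ aᵢ ⊗ bᵢ` and `Y = ∑ cⱼ ⊗ gⱼ` satisfy `IsAntiCanonical`, so does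
`X₁₂ Y₁₃ = ∑ aᵢ cⱼ ⊗ (bᵢ ⊗ gⱼ)`, as the values of the two factors commute in `A ⊗ A`. -/
lemma IsAntiCanonical.tmul {a b : ι → A} {c g : κ → A} (h : IsAntiCanonical k a b)
    (h' : IsAntiCanonical k c g) :
    IsAntiCanonical k (fun p : ι × κ => a p.1 * c p.2) (fun p => b p.1 ⊗ₜ[k] g p.2) where
  counit_smul := by
    have := congrArg₂ (fun x y : A => x ⊗ₜ[k] y) h.counit_smul h'.counit_smul
    simp only [TensorProduct.sum_tmul, TensorProduct.tmul_sum, TensorProduct.smul_tmul_smul] at this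
    rw [Fintype.sum_prod_type, Finset.sum_comm]
    simp only [Bialgebra.counit_mul]
    exact this
  comul_tmul := by
    rw [Fintype.sum_prod_type]
    let F : κ → (A ⊗[k] A) ⊗[k] A →ₗ[k] (A ⊗[k] A) ⊗[k] (A ⊗[k] A) := fun j =>
      TensorProduct.map (LinearMap.mulRight k (comul (c j))) ((TensorProduct.mk k A A).flip (g j))
    have h1 : ∀ j, _ := fun j => h.sum_comul (F j)
    let G : ι → ι → (A ⊗[k] A) ⊗[k] A →ₗ[k] (A ⊗[k] A) ⊗[k] (A ⊗[k] A) := fun i i' =>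
      TensorProduct.map (LinearMap.mulLeft k (a i ⊗ₜ a i')) ((TensorProduct.mk k A A) (b i' * b i))
    have h2 : ∀ i i', _ := fun i i' => h'.sum_comul (G i i')
    simp only [F, G, TensorProduct.map_tmul, LinearMap.mulRight_apply, LinearMap.mulLeft_apply,
      LinearMap.flip_apply, TensorProduct.mk_apply, Algebra.TensorProduct.tmul_mul_tmul] at h1 h2
    simp only [Bialgebra.comul_mul, Fintype.sum_prod_type, Algebra.TensorProduct.tmul_mul_tmul]
    rw [Finset.sum_comm]
    simp_rw [h1]
    rw [Finset.sum_comm]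
    refine Finset.sum_congr rfl fun i _ => ?_
    rw [Finset.sum_comm]
    simp_rw [h2]
    rw [Finset.sum_comm]

variable [FiniteDimensional k A]

/-- If `X = ∑ aᵢ ⊗ bᵢ` and `Y = ∑ cⱼ ⊗ gⱼ` are inverse to each other in the sense of `hinv`, and
`u = ∑ bᵢ aᵢ` implements `S²`, then the element attached to `X₁₂ Y₁₃` and `Δ` is the tensor
product of the elements attached to `X` and `Y`. -/
lemma IsAntiCanonical.sum_tmul_mul_comul {a b : ι → A} {c g : κ → A} (h : IsAntiCanonical k a b)
    (h' : IsAntiCanonical k c g)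
    (hu : ∀ x, (∑ i, b i * a i) * x = antipode k (antipode k x) * ∑ i, b i * a i)
    (hinv : ∑ i, ∑ j, (antipodeInv k A (antipodeInv k A (b i)) * c j) ⊗ₜ[k] (g j * a i) = 1) :
    ∑ p : ι × κ, (b p.1 ⊗ₜ[k] g p.2) * comul (a p.1 * c p.2) =
      (∑ i, b i * a i) ⊗ₜ (∑ j, g j * c j) := by
  set u := ∑ i, b i * a i with hudef
  let F : κ → (A ⊗[k] A) ⊗[k] A →ₗ[k] (A ⊗[k] A) := fun j =>
    LinearMap.mulRight k (comul (c j)) ∘ₗ LinearMap.mul' k (A ⊗[k] A) ∘ₗ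
      (TensorProduct.comm k (A ⊗[k] A) (A ⊗[k] A)).toLinearMap ∘ₗ
        LinearMap.lTensor (A ⊗[k] A) ((TensorProduct.mk k A A).flip (g j))
  have hF : ∀ j t z, F j (t ⊗ₜ z) = (z ⊗ₜ g j) * t * comul (c j) := by
    intro j t z; simp [F]
  have h1 : ∀ j, ∑ i, (b i ⊗ₜ[k] g j) * comul (a i * c j) =
      ∑ i, ((b i * u) ⊗ₜ (g j * a i)) * comul (c j) := by
    intro j
    have := h.sum_comul (F j)
    simp only [hF] at this
    simp only [Bialgebra.comul_mul, ← mul_assoc]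
    rw [this, Finset.sum_comm]
    refine Finset.sum_congr rfl fun i _ => ?_
    rw [hudef, Finset.mul_sum, TensorProduct.sum_tmul, Finset.sum_mul]
    simp [mul_assoc]
  let G : ι → (A ⊗[k] A) ⊗[k] A →ₗ[k] (A ⊗[k] A) := fun i =>
    LinearMap.mul' k (A ⊗[k] A) ∘ₗ
      (TensorProduct.comm k (A ⊗[k] A) (A ⊗[k] A)).toLinearMap ∘ₗ
        LinearMap.lTensor (A ⊗[k] A) (TensorProduct.mk k A A (b i * u) ∘ₗ LinearMap.mulRight k (a i))
  have hG : ∀ i t z, G i (t ⊗ₜ z) = ((b i * u) ⊗ₜ (z * a i)) * t := by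
    intro i t z; simp [G]
  have h2 : ∀ i, ∑ j, ((b i * u) ⊗ₜ[k] (g j * a i)) * comul (c j) =
      ∑ j', ∑ j, (u ⊗ₜ g j') * ((antipodeInv k A (antipodeInv k A (b i)) * c j) ⊗ₜ (g j * a i)) *
        (1 ⊗ₜ[k] c j') := by
    intro i
    have := h'.sum_comul (G i)
    simp only [hG] at this
    rw [this, Finset.sum_comm]
    refine Finset.sum_congr rfl fun j' _ => Finset.sum_congr rfl fun j _ => ?_
    -- moving `u` to the left turns `b i` into `S⁻² (b i)`, and then `hinv` applies
    have hb : b i * u = u * antipodeInv k A (antipodeInv k A (b i)) := by simp [hu]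
    simp [hb, mul_assoc]
  rw [Fintype.sum_prod_type, Finset.sum_comm]
  simp_rw [h1]
  rw [Finset.sum_comm]
  simp_rw [h2]
  rw [Finset.sum_comm, TensorProduct.tmul_sum]
  refine Finset.sum_congr rfl fun j' _ => ?_
  simp_rw [← Finset.sum_mul, ← Finset.mul_sum, hinv]
  simp

/-- If a Hopf algebra `A` is spanned by the products of (the images of) two Hopf algebras `P` and
`Q`, then `(P ⊗ Q) Δ(A)` spans `A ⊗ A`. -/
lemma eq_top_of_mul_comul_mem {P Q : Type*} [Ring P] [HopfAlgebra k P] [Ring Q]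
    [HopfAlgebra k Q] [FiniteDimensional k Q] (i : P →ₐc[k] A) (j : Q →ₐc[k] A)
    (hij : Submodule.span k (Set.range fun x : P × Q => i x.1 * j x.2) = ⊤)
    (N : Submodule k (A ⊗[k] A)) (hN : ∀ p q d, (i p ⊗ₜ[k] j q) * comul d ∈ N) : N = ⊤ := by
  -- the antipode interchanges the two orders of the factors
  have hji : Submodule.span k (Set.range fun x : P × Q => j x.2 * i x.1) = ⊤ := by
    refine eq_top_iff.mpr fun y _ => ?_
    obtain ⟨x, rfl⟩ := antipode_surjective (k := k) y
    have hx : x ∈ Submodule.span k (Set.range fun x : P × Q => i x.1 * j x.2) := hij ▸ trivial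
    induction hx using Submodule.span_induction with
    | mem x hx =>
      obtain ⟨⟨p, q⟩, rfl⟩ := hx
      refine Submodule.subset_span ⟨(antipode k p, antipode k q), ?_⟩
      simp [antipode_mul_antidistrib, antipode_bialgHom]
    | zero => simp
    | add x y _ _ hx hy => rw [map_add]; exact add_mem (hx trivial) (hy trivial)
    | smul c x _ hx => rw [map_smul]; exact Submodule.smul_mem _ _ (hx trivial)
  have hΔi : ∀ p : P, comul (R := k) (i p) = ∑ l ∈ (ℛ k p).index,
      i ((ℛ k p).left l) ⊗ₜ i ((ℛ k p).right l) := by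
    intro p
    rw [← CoalgHomClass.map_comp_comul_apply, ← (ℛ k p).eq]
    simp
  have hΔj : ∀ q : Q, comul (R := k) (j q) = ∑ l ∈ (ℛ k q).index,
      j ((ℛ k q).left l) ⊗ₜ j ((ℛ k q).right l) := by
    intro q
    rw [← CoalgHomClass.map_comp_comul_apply, ← (ℛ k q).eq]
    simp
  have h1 : ∀ p x d, (i p ⊗ₜ[k] x) * comul d ∈ N := by
    intro p x d
    have hx : x ∈ Submodule.span k (Set.range fun x : P × Q => j x.2 * i x.1) := hji ▸ trivial
    induction hx using Submodule.span_induction with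
    | mem x hx =>
      obtain ⟨⟨r, q⟩, rfl⟩ := hx
      -- `1 ⊗ r = (S(r₁) ⊗ 1) Δ(r₂)`
      let F : P ⊗[k] (P ⊗[k] P) →ₗ[k] A ⊗[k] A :=
        LinearMap.mulRight k (comul d) ∘ₗ LinearMap.mulLeft k (i p ⊗ₜ j q) ∘ₗ
          TensorProduct.map ((i : P →ₐ[k] A).toLinearMap ∘ₗ LinearMap.mul' k P ∘ₗ
            (antipode k).rTensor P) (i : P →ₐ[k] A).toLinearMap ∘ₗ
            (TensorProduct.assoc k P P P).symm.toLinearMap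
      have hF := sum_coassoc F r
      have hl : ∑ l ∈ (ℛ k r).index, ∑ m ∈ (ℛ k ((ℛ k r).left l)).index,
          F ((ℛ k ((ℛ k r).left l)).left m ⊗ₜ ((ℛ k ((ℛ k r).left l)).right m ⊗ₜ
            (ℛ k r).right l)) = (i p ⊗ₜ[k] (j q * i r)) * comul d := by
        simp only [F, LinearMap.comp_apply, LinearEquiv.coe_coe, TensorProduct.assoc_symm_tmul,
          TensorProduct.map_tmul, LinearMap.rTensor_tmul, LinearMap.mul'_apply,
          LinearMap.mulLeft_apply, LinearMap.mulRight_apply, AlgHom.toLinearMap_apply]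
        simp only [← Finset.sum_mul, ← Finset.mul_sum, ← TensorProduct.sum_tmul, ← map_sum,
          sum_antipode_mul_eq_smul]
        congr 1
        conv_rhs => rw [← sum_counit_smul (R := k) (ℛ k r)]
        simp [Finset.mul_sum, TensorProduct.tmul_sum, TensorProduct.smul_tmul]
      have hr : ∀ l, ∑ m ∈ (ℛ k ((ℛ k r).right l)).index,
          F ((ℛ k r).left l ⊗ₜ ((ℛ k ((ℛ k r).right l)).left m ⊗ₜ
            (ℛ k ((ℛ k r).right l)).right m)) =
            (i (p * antipode k ((ℛ k r).left l)) ⊗ₜ j q) * comul (i ((ℛ k r).right l) * d) := by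
        intro l
        simp only [Bialgebra.comul_mul, ← mul_assoc]
        simp [F, hΔi, Finset.sum_mul, Finset.mul_sum, mul_assoc]
      rw [← hl, hF]
      exact sum_mem fun l _ => by rw [hr]; exact hN _ _ _
    | zero => simp
    | add x y _ _ hx hy => rw [TensorProduct.tmul_add, add_mul]; exact add_mem hx hy
    | smul c x _ hx => rw [TensorProduct.tmul_smul, smul_mul_assoc]; exact Submodule.smul_mem _ _ hx
  have h2 : ∀ x y, x ⊗ₜ[k] y ∈ N := by
    intro x y
    have hx : x ∈ Submodule.span k (Set.range fun x : P × Q => i x.1 * j x.2) := hij ▸ trivial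
    induction hx using Submodule.span_induction with
    | mem x hx =>
      obtain ⟨⟨p, q⟩, rfl⟩ := hx
      -- `q ⊗ 1 = (1 ⊗ S⁻¹(q₂)) Δ(q₁)`
      let F : Q ⊗[k] (Q ⊗[k] Q) →ₗ[k] A ⊗[k] A :=
        LinearMap.mulLeft k (i p ⊗ₜ y) ∘ₗ
          TensorProduct.map (j : Q →ₐ[k] A).toLinearMap ((j : Q →ₐ[k] A).toLinearMap ∘ₗ
            LinearMap.mul' k Q ∘ₗ (TensorProduct.comm k Q Q).toLinearMap ∘ₗ
              (antipodeInv k Q).lTensor Q)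
      have hF := sum_coassoc F q
      have hl : ∀ l, ∑ m ∈ (ℛ k ((ℛ k q).left l)).index,
          F ((ℛ k ((ℛ k q).left l)).left m ⊗ₜ ((ℛ k ((ℛ k q).left l)).right m ⊗ₜ
            (ℛ k q).right l)) = (i p ⊗ₜ[k] (y * j (antipodeInv k Q ((ℛ k q).right l)))) *
              comul (j ((ℛ k q).left l)) := by
        intro l
        simp [F, hΔj, Finset.mul_sum, mul_assoc]
      have hr : ∑ l ∈ (ℛ k q).index, ∑ m ∈ (ℛ k ((ℛ k q).right l)).index,
          F ((ℛ k q).left l ⊗ₜ ((ℛ k ((ℛ k q).right l)).left m ⊗ₜ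
            (ℛ k ((ℛ k q).right l)).right m)) = (i p * j q) ⊗ₜ y := by
        simp only [F, LinearMap.comp_apply, LinearEquiv.coe_coe, TensorProduct.comm_tmul,
          TensorProduct.map_tmul, LinearMap.lTensor_tmul, LinearMap.mul'_apply,
          LinearMap.mulLeft_apply, AlgHom.toLinearMap_apply]
        simp only [← Finset.mul_sum, ← TensorProduct.tmul_sum, ← map_sum,
          sum_antipodeInv_mul]
        conv_rhs => rw [← sum_counit_smul_left (k := k) q]
        simp [Finset.mul_sum, TensorProduct.sum_tmul, TensorProduct.smul_tmul']
      show (i p * j q) ⊗ₜ y ∈ N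
      rw [← hr, ← hF]
      exact sum_mem fun l _ => by rw [hl]; exact h1 _ _ _
    | zero => simp
    | add x y _ _ hx hy => rw [TensorProduct.add_tmul]; exact add_mem hx hy
    | smul c x _ hx => rw [← TensorProduct.smul_tmul']; exact Submodule.smul_mem _ _ hx
  refine eq_top_iff.mpr fun t _ => ?_
  induction t with
  | zero => simp
  | add s t hs ht => exact add_mem (hs trivial) (ht trivial)
  | tmul x y => exact h2 x y

end TensorSquare
/-! ### The canonical element of a Hopf algebra and its dual -/

section Canonical
variable {k H ι : Type*} [Field k] [Ring H] [HopfAlgebra k H] [FiniteDimensional k H] [Fintype ι]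
  (e : Module.Basis ι k H)

/-- The basis `eⁱ` of `H^{*cop}` dual to the basis `eᵢ` of `H`. -/
noncomputable def dualFam (i : ι) : DualCop k H := (toDual k H).symm (e.coord i)

@[simp] lemma toDual_dualFam (i : ι) (x : H) : toDual k H (dualFam e i) x = e.repr x i := by
  simp [dualFam]

lemma sum_smul_dualFam (q : Module.Dual k H) :
    ∑ i, q (e i) • dualFam e i = (toDual k H).symm q := by
  apply (toDual k H).injective
  refine e.ext fun j => ?_
  classical
  simp [Finsupp.single_apply]

lemma sum_toDual_smul_dualFam (q : DualCop k H) :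
    ∑ i, toDual k H q (e i) • dualFam e i = q := by
  rw [sum_smul_dualFam, LinearEquiv.symm_apply_apply]

lemma sum_repr_smul {X : Type*} [AddCommGroup X] [Module k X] (F : H →ₗ[k] X) (x : H) :
    ∑ i, e.repr x i • F (e i) = F x := by
  simp_rw [← map_smul, ← map_sum, e.sum_repr]

/-- Contraction of the factor `H^{*cop}` of a tensor product by evaluation at `x`. -/
noncomputable def evalR (k : Type*) {H : Type*} [Field k] [Ring H] [HopfAlgebra k H]
    (X : Type*) [AddCommGroup X] [Module k X] (x : H) : X ⊗[k] DualCop k H →ₗ[k] X :=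
  (TensorProduct.rid k X).toLinearMap ∘ₗ
    (Module.Dual.eval k H x ∘ₗ (toDual k H).toLinearMap).lTensor X

variable {X : Type*} [AddCommGroup X] [Module k X]

@[simp] lemma evalR_tmul (x : H) (y : X) (q : DualCop k H) :
    evalR k X x (y ⊗ₜ q) = toDual k H q x • y := by
  simp [evalR]

lemma tmul_dual_ext {t t' : X ⊗[k] DualCop k H} (h : ∀ x, evalR k X x t = evalR k X x t') :
    t = t' := by
  have key : ∀ t : X ⊗[k] DualCop k H, t = ∑ i, evalR k X (Module.finBasis k H i) t ⊗ₜ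
      dualFam (Module.finBasis k H) i := by
    intro t
    induction t with
    | zero => simp
    | add s t hs ht =>
      simp only [map_add, TensorProduct.add_tmul, Finset.sum_add_distrib, ← hs, ← ht]
    | tmul y q =>
      conv_lhs => rw [← sum_toDual_smul_dualFam (Module.finBasis k H) q]
      simp [TensorProduct.tmul_sum, TensorProduct.smul_tmul]
  rw [key t, key t']
  simp_rw [h]

lemma tmul_ext {t t' : X ⊗[k] H} (h : ∀ q : Module.Dual k H,
    TensorProduct.rid k X (q.lTensor X t) = TensorProduct.rid k X (q.lTensor X t')) :
    t = t' := by
  have key : ∀ t : X ⊗[k] H, t = ∑ i, TensorProduct.rid k X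
      (((Module.finBasis k H).coord i).lTensor X t) ⊗ₜ Module.finBasis k H i := by
    intro t
    induction t with
    | zero => simp
    | add s t hs ht =>
      simp only [map_add, TensorProduct.add_tmul, Finset.sum_add_distrib, ← hs, ← ht]
    | tmul y q =>
      simpa [TensorProduct.smul_tmul] using (sum_repr_smul (Module.finBasis k H)
        (TensorProduct.mk k X H y) q).symm
  rw [key t, key t']
  simp_rw [h]

lemma antipode_dual_apply (q : DualCop k H) (x : H) :
    toDual k H (antipode k q) x = toDual k H q (antipodeInv k H x) := toDual_antipodeLin q x

lemma antipodeInv_dual_apply (q : DualCop k H) (x : H) :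
    toDual k H (antipodeInv k (DualCop k H) q) x = toDual k H q (antipode k x) := by
  obtain ⟨q, rfl⟩ := antipode_surjective (k := k) q
  rw [antipodeInv_antipode, antipode_dual_apply, antipodeInv_antipode]

/-- `∑ Δ(eᵢ) ⊗ eⁱ = ∑ eᵢ ⊗ eⱼ ⊗ eⁱ eʲ`, after applying a linear map to `H ⊗ H`. -/
lemma sum_comul_tmul_dualFam (F : H ⊗[k] H →ₗ[k] X) :
    ∑ i, F (comul (e i)) ⊗ₜ[k] dualFam e i =
      ∑ i, ∑ j, F (e i ⊗ₜ e j) ⊗ₜ[k] (dualFam e i * dualFam e j) := by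
  apply tmul_dual_ext
  intro x
  simp only [map_sum, evalR_tmul, DualCop.toDual_mul, toDual_dualFam]
  refine (sum_repr_smul e (F ∘ₗ comul) x).trans ?_
  rw [LinearMap.comp_apply, ← (ℛ k x).eq, map_sum]
  simp only [Finset.sum_smul]
  simp_rw [Finset.sum_comm (s := Finset.univ) (t := (ℛ k x).index)]
  refine Finset.sum_congr rfl fun l _ => ?_
  simp only [mul_smul]
  simp_rw [← Finset.smul_sum]
  have h1 : ∀ i, ∑ j, e.repr ((ℛ k x).right l) j • F (e i ⊗ₜ e j) =
      F (e i ⊗ₜ (ℛ k x).right l) := fun i =>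
    sum_repr_smul e (F ∘ₗ TensorProduct.mk k H H (e i)) _
  simp_rw [h1]
  exact (sum_repr_smul e (F ∘ₗ (TensorProduct.mk k H H).flip ((ℛ k x).right l)) _).symm

/-- The order of `e j * e i` is opposite because `H^{*cop}` carries the opposite coproduct. -/
lemma sum_tmul_comul_dualFam :
    ∑ i, comul (R := k) (dualFam e i) ⊗ₜ[k] e i =
      ∑ i, ∑ j, (dualFam e i ⊗ₜ[k] dualFam e j) ⊗ₜ[k] (e j * e i) := by
  apply tmul_ext
  intro q
  apply pair_ext
  intro x y
  simp only [map_sum, LinearMap.lTensor_tmul, TensorProduct.rid_tmul, map_smul, pair_comul,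
    LinearMap.sum_apply, LinearMap.smul_apply, pair_tmul, toDual_dualFam, smul_eq_mul]
  have h1 := congrArg q (e.sum_repr (y * x))
  have h2 := congrArg q (congrArg₂ (· * ·) (e.sum_repr y) (e.sum_repr x))
  simp only [Finset.sum_mul_sum, map_sum, map_smul, smul_mul_smul_comm, smul_eq_mul] at h1 h2
  rw [Finset.sum_comm]
  simp only [mul_comm (q _), mul_comm (e.repr x _)]
  rw [h1, h2]

/-- On the canonical element, the antipode of `H^{*cop}` acts as the inverse antipode of `H`. -/
lemma sum_tmul_antipode_dualFam (F : H →ₗ[k] X) :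
    ∑ i, F (e i) ⊗ₜ[k] antipode k (dualFam e i) =
      ∑ i, F (antipodeInv k H (e i)) ⊗ₜ[k] dualFam e i := by
  apply tmul_dual_ext
  intro x
  simp only [map_sum, evalR_tmul, antipode_dual_apply, toDual_dualFam]
  rw [sum_repr_smul, ← LinearMap.comp_apply, ← sum_repr_smul e]
  rfl

lemma sum_tmul_antipodeInv_dualFam (F : H →ₗ[k] X) :
    ∑ i, F (e i) ⊗ₜ[k] antipodeInv k (DualCop k H) (dualFam e i) =
      ∑ i, F (antipode k (e i)) ⊗ₜ[k] dualFam e i := by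
  apply tmul_dual_ext
  intro x
  simp only [map_sum, evalR_tmul, antipodeInv_dual_apply, toDual_dualFam]
  rw [sum_repr_smul, ← LinearMap.comp_apply, ← sum_repr_smul e]
  rfl

lemma sum_smul_dualFam_one : ∑ i, counit (R := k) (e i) • dualFam e i = 1 :=
  sum_smul_dualFam e counit

lemma sum_toDual_one_smul : ∑ i, counit (R := k) (dualFam e i) • e i = 1 := by
  simp

lemma isAntiCanonical_basis :
    IsAntiCanonical k (fun i => e i) (fun i => antipode k (dualFam e i)) where
  counit_smul := by
    simpa only [map_sum, map_smul, antipode_one] using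
      congrArg (antipode k) (sum_smul_dualFam_one e)
  comul_tmul := by
    simpa [antipode_mul_antidistrib] using congrArg (LinearMap.lTensor (H ⊗[k] H) (antipode k))
      (sum_comul_tmul_dualFam e LinearMap.id)

lemma isAntiCanonical_dualFam :
    IsAntiCanonical k (fun i => dualFam e i) (fun i => antipode k (antipode k (e i))) where
  counit_smul := by
    simpa only [map_sum, map_smul, antipode_one] using
      congrArg (fun x => antipode k (antipode k x)) (sum_toDual_one_smul e)
  comul_tmul := by
    simpa [antipode_mul_antidistrib] using congrArg
      (LinearMap.lTensor (DualCop k H ⊗[k] DualCop k H) (antipode k ∘ₗ antipode k))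
      (sum_tmul_comul_dualFam e)

/-- Moving all antipodes to `H`, the left-hand side becomes `∑ S²(x₂) S(x₁) ⊗ x^*` over dual bases
`x`, `x^*`, and `S²(x₂) S(x₁) = ε(x)`. -/
lemma sum_mul_antipodeInv_dualFam : ∑ i, ∑ j, (antipode k (antipode k (e j)) * e i) ⊗ₜ[k]
    (antipodeInv k (DualCop k H) (dualFam e i) * dualFam e j) = 1 := by
  have h1 : ∀ j, _ := fun j => congrArg (LinearMap.lTensor H (LinearMap.mulRight k (dualFam e j)))
    (sum_tmul_antipodeInv_dualFam e (LinearMap.mulLeft k (antipode k (antipode k (e j)))))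
  simp only [map_sum, LinearMap.lTensor_tmul, LinearMap.mulRight_apply,
    LinearMap.mulLeft_apply] at h1
  rw [Finset.sum_comm]
  simp_rw [h1]
  rw [Finset.sum_comm]
  have h2 := sum_comul_tmul_dualFam e (LinearMap.mul' k H ∘ₗ
    (TensorProduct.comm k H H).toLinearMap ∘ₗ
      TensorProduct.map (antipode k) (antipode k ∘ₗ antipode k))
  simp only [LinearMap.comp_apply, TensorProduct.map_tmul, LinearEquiv.coe_coe,
    TensorProduct.comm_tmul, LinearMap.mul'_apply] at h2
  rw [← h2]
  have h3 : ∀ x : H, LinearMap.mul' k H (TensorProduct.comm k H H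
      (TensorProduct.map (antipode k) (antipode k ∘ₗ antipode k) (comul x))) =
      counit (R := k) x • 1 := by
    intro x
    conv_lhs => rw [← (ℛ k x).eq]
    simp only [map_sum, TensorProduct.map_tmul, TensorProduct.comm_tmul, LinearMap.mul'_apply,
      LinearMap.comp_apply]
    simp_rw [← antipode_mul_antidistrib, ← map_sum, sum_mul_antipode_eq_smul, map_smul,
      antipode_one]
  simp_rw [h3, TensorProduct.smul_tmul]
  rw [← TensorProduct.tmul_sum, sum_smul_dualFam_one]
  rfl

/-- Moving all antipodes to `H`, the left-hand side becomes `∑ S⁻¹(x₂) x₁ ⊗ x^*` over dual bases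
`x`, `x^*`, and `S⁻¹(x₂) x₁ = ε(x)`. -/
lemma sum_mul_antipode_dualFam : ∑ i, ∑ j, (e j * antipode k (antipode k (e i))) ⊗ₜ[k]
    (antipode k (antipode k (dualFam e i)) * antipode k (dualFam e j)) = 1 := by
  have h1 : ∀ i, _ := fun i => congrArg (LinearMap.lTensor H (LinearMap.mulLeft k
      (antipode k (antipode k (dualFam e i)))))
    (sum_tmul_antipode_dualFam e (LinearMap.mulRight k (antipode k (antipode k (e i)))))
  have h2 : ∀ j, _ := fun j => congrArg (LinearMap.lTensor H (LinearMap.mulRight k (dualFam e j)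
      ∘ₗ antipode k))
    (sum_tmul_antipode_dualFam e (LinearMap.mulLeft k (antipodeInv k H (e j)) ∘ₗ antipode k ∘ₗ
      antipode k))
  have h3 : ∀ j, _ := fun j => congrArg (LinearMap.lTensor H (LinearMap.mulRight k (dualFam e j)))
    (sum_tmul_antipode_dualFam e (LinearMap.mulLeft k (antipodeInv k H (e j)) ∘ₗ antipode k))
  simp only [map_sum, LinearMap.lTensor_tmul, LinearMap.mulRight_apply, LinearMap.comp_apply,
    LinearMap.mulLeft_apply, antipode_antipodeInv] at h1 h2 h3
  simp_rw [h1]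
  rw [Finset.sum_comm]
  simp_rw [h2, h3]
  rw [Finset.sum_comm]
  have h4 := sum_comul_tmul_dualFam e (LinearMap.mul' k H ∘ₗ
    (TensorProduct.comm k H H).toLinearMap ∘ₗ (antipodeInv k H).lTensor H)
  simp only [LinearMap.comp_apply, LinearMap.lTensor_tmul, LinearEquiv.coe_coe,
    TensorProduct.comm_tmul, LinearMap.mul'_apply] at h4
  rw [← h4]
  have h5 : ∀ x : H, LinearMap.mul' k H (TensorProduct.comm k H H
      ((antipodeInv k H).lTensor H (comul x))) = counit (R := k) x • 1 := by
    intro x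
    conv_lhs => rw [← (ℛ k x).eq]
    simp [sum_antipodeInv_mul]
  simp_rw [h5, TensorProduct.smul_tmul]
  rw [← TensorProduct.tmul_sum, sum_smul_dualFam_one]
  rfl

end Canonical
/-! ### The commutation relation of the Drinfeld double -/

lemma twMul_mul_scal {k B : Type*} [CommRing k] [Ring B] [Bialgebra k B] {σ σ' : B ⊗[k] B →ₗ[k] k}
    (h : toConv σ' * toConv σ = 1) :
    toConv (twMul σ σ') * scal B σ = scal B σ * toConv (LinearMap.mul' k B) := by
  rw [twMul, toConv_ofConv, mul_assoc, scal_mul_eq_one h, mul_one]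

section DoubleRelations
variable (k H : Type*) [Field k] [Ring H] [HopfAlgebra k H] [FiniteDimensional k H]

/-- The inclusion `p ↦ p ⊗ 1` as a map of bialgebras. -/
noncomputable def inlHom : DualCop k H →ₐc[k] DrinfeldDouble k H where
  toCoalgHom := (show DualCop k H →ₗc[k] DrinfeldDouble k H from coalgInl k H)
  map_one' := map_one (inl k H)
  map_mul' := map_mul (inl k H)

/-- The inclusion `h ↦ 1 ⊗ h` as a map of bialgebras. -/
noncomputable def inrHom : H →ₐc[k] DrinfeldDouble k H where
  toCoalgHom := (show H →ₗc[k] DrinfeldDouble k H from coalgInr k H)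
  map_one' := map_one (inr k H)
  map_mul' := map_mul (inr k H)

variable {k H}

lemma inlHom_apply (p : DualCop k H) :
    inlHom k H p = CocycleTwist.of (doubleCocycle k H) (p ⊗ₜ 1) := coalgInl_apply p

lemma inrHom_apply (h : H) :
    inrHom k H h = CocycleTwist.of (doubleCocycle k H) (1 ⊗ₜ h) := coalgInr_apply h

lemma inlHom_mul_inrHom (p : DualCop k H) (h : H) :
    inlHom k H p * inrHom k H h = CocycleTwist.of (doubleCocycle k H) (p ⊗ₜ h) := by
  rw [inlHom_apply, inrHom_apply, CocycleTwist.of_mul]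
  refine congrArg (CocycleTwist.of (doubleCocycle k H)) ?_
  refine (twMul_one_tmul p 1 h).trans ?_
  rw [mul_one]

lemma span_inlHom_mul_inrHom : Submodule.span k
    (Set.range fun x : DualCop k H × H => inlHom k H x.1 * inrHom k H x.2) = ⊤ := by
  refine eq_top_iff.mpr fun y _ => ?_
  obtain ⟨t, rfl⟩ := (CocycleTwist.of (doubleCocycle k H)).surjective y
  induction t with
  | zero => simp
  | add s t hs ht => rw [map_add]; exact add_mem (hs trivial) (ht trivial)
  | tmul p h => exact Submodule.subset_span ⟨(p, h), inlHom_mul_inrHom p h⟩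

/-- The commutation relation of the double in terms of the twisted product: the identity
`(x · y) σ = σ (x y)` between the twisted and the untwisted product, at `x = h` and `y = q`. -/
lemma sum_smul_twMul (q : DualCop k H) (h : H) :
    ∑ l ∈ (ℛ k h).index, ∑ m ∈ (ℛ k q).index,
      toDual k H ((ℛ k q).right m) ((ℛ k h).right l) •
        twMul (sigma k H) (sigmaInv k H) ((1 ⊗ₜ (ℛ k h).left l) ⊗ₜ ((ℛ k q).left m ⊗ₜ 1)) =
    ∑ l ∈ (ℛ k h).index, ∑ m ∈ (ℛ k q).index,
      toDual k H ((ℛ k q).left m) ((ℛ k h).left l) •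
        ((ℛ k q).right m ⊗ₜ[k] (ℛ k h).right l) := by
  have h1 := twMul_mul_scal (sigmaInv_mul_sigma (k := k) (H := H))
  have h3 := scal_sigma_mul (1 : DualCop k H) q h 1
  rw [← h1] at h3
  simp only [one_mul, mul_one] at h3
  rw [← h3]
  -- for the unit, the representative `Δ(1) = 1 ⊗ 1` replaces the arbitrary one
  let r : Repr k (1 : H) Unit := ⟨{()}, fun _ => 1, fun _ => 1, by
    simp [Algebra.TensorProduct.one_def]⟩
  let r' : Repr k (1 : DualCop k H) Unit := ⟨{()}, fun _ => 1, fun _ => 1, by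
    simp [Algebra.TensorProduct.one_def]⟩
  refine Eq.trans ?_ (((r'.tmul (ℛ k h)).tmul ((ℛ k q).tmul r)).convMul_apply
    (toConv (twMul (sigma k H) (sigmaInv k H))) (scal (DualCop k H ⊗[k] H) (sigma k H))).symm
  generalize twMul (sigma k H) (sigmaInv k H) = u
  simp only [Coalgebra.Repr.tmul, Finset.sum_product, r, r', Finset.sum_singleton, scal,
    LinearMap.comp_apply, sigma_tmul, Algebra.linearMap_apply,
    mul_algebraMap_eq_smul, DualCop.toDual_one, Bialgebra.counit_one, one_mul, mul_one]

/-- The defining commutation relation of the Drinfeld double: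
`∑ q₂(h₂) h₁ q₁ = ∑ q₁(h₁) q₂ h₂`. -/
lemma sum_inrHom_mul_inlHom (q : DualCop k H) (h : H) :
    ∑ l ∈ (ℛ k h).index, ∑ m ∈ (ℛ k q).index,
      toDual k H ((ℛ k q).right m) ((ℛ k h).right l) •
        (inrHom k H ((ℛ k h).left l) * inlHom k H ((ℛ k q).left m)) =
    ∑ l ∈ (ℛ k h).index, ∑ m ∈ (ℛ k q).index,
      toDual k H ((ℛ k q).left m) ((ℛ k h).left l) •
        (inlHom k H ((ℛ k q).right m) * inrHom k H ((ℛ k h).right l)) := by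
  have := congrArg (CocycleTwist.of (doubleCocycle k H)) (sum_smul_twMul q h)
  simp only [map_sum, map_smul] at this
  simp only [inlHom_mul_inrHom]
  simp only [inlHom_apply, inrHom_apply, CocycleTwist.of_mul]
  exact this

end DoubleRelations

/-! ### The universal `R`-matrix and the Drinfeld element -/

section DrinfeldElement
variable {k H ι : Type*} [Field k] [Ring H] [HopfAlgebra k H] [FiniteDimensional k H] [Fintype ι]
  (e : Module.Basis ι k H)

lemma comul_inlHom (p : DualCop k H) : comul (R := k) (inlHom k H p) =
    ∑ m ∈ (ℛ k p).index, inlHom k H ((ℛ k p).left m) ⊗ₜ inlHom k H ((ℛ k p).right m) := by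
  rw [← CoalgHomClass.map_comp_comul_apply, ← (ℛ k p).eq]
  simp

lemma comul_inrHom (h : H) : comul (R := k) (inrHom k H h) =
    ∑ m ∈ (ℛ k h).index, inrHom k H ((ℛ k h).left m) ⊗ₜ inrHom k H ((ℛ k h).right m) := by
  rw [← CoalgHomClass.map_comp_comul_apply, ← (ℛ k h).eq]
  simp

/-- The case `x = h` of `R Δ(x) = Δ^{op}(x) R`: contracting the factor `H` against functionals `q`
reduces it to the commutation relation of `q` and `h`. -/
lemma rMatrix_mul_comul_inr (h : H) :
    (∑ i, inrHom k H (e i) ⊗ₜ[k] inlHom k H (dualFam e i)) * comul (inrHom k H h) =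
      TensorProduct.comm k _ _ (comul (inrHom k H h)) *
        ∑ i, inrHom k H (e i) ⊗ₜ[k] inlHom k H (dualFam e i) := by
  have key : ∑ i, ∑ l ∈ (ℛ k h).index,
      (inlHom k H (dualFam e i) * inrHom k H ((ℛ k h).right l)) ⊗ₜ[k] (e i * (ℛ k h).left l) =
      ∑ i, ∑ l ∈ (ℛ k h).index, (inrHom k H ((ℛ k h).left l) * inlHom k H (dualFam e i)) ⊗ₜ[k]
        ((ℛ k h).right l * e i) := by
    apply tmul_ext
    intro φ
    obtain ⟨q, rfl⟩ := (toDual k H).surjective φ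
    have e1 : ∀ x, ∑ i, toDual k H q (e i * x) • inlHom k H (dualFam e i) =
        ∑ m ∈ (ℛ k q).index, toDual k H ((ℛ k q).left m) x • inlHom k H ((ℛ k q).right m) := by
      intro x
      simp_rw [← map_smul, ← map_sum]
      congr 1
      refine (sum_smul_dualFam e (toDual k H q ∘ₗ LinearMap.mulRight k x)).trans ?_
      apply DualCop.ext'
      intro y
      simp [sum_pair_comul]
    have e2 : ∀ x, ∑ i, toDual k H q (x * e i) • inlHom k H (dualFam e i) =
        ∑ m ∈ (ℛ k q).index, toDual k H ((ℛ k q).right m) x • inlHom k H ((ℛ k q).left m) := by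
      intro x
      simp_rw [← map_smul, ← map_sum]
      congr 1
      refine (sum_smul_dualFam e (toDual k H q ∘ₗ LinearMap.mulLeft k x)).trans ?_
      apply DualCop.ext'
      intro y
      simp [mul_comm (toDual k H _ x), sum_pair_comul]
    simp only [map_sum, LinearMap.lTensor_tmul, TensorProduct.rid_tmul]
    simp only [Finset.sum_comm (s := Finset.univ)]
    simp only [← smul_mul_assoc, ← mul_smul_comm (_ : k) (inrHom k H _) (inlHom k H _),
      ← Finset.sum_mul, ← Finset.mul_sum, e1, e2]
    simpa [Finset.sum_mul, Finset.mul_sum] using (sum_inrHom_mul_inlHom q h).symm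
  have := congrArg (TensorProduct.comm k _ _ ∘
    ((inrHom k H : H →ₐ[k] DrinfeldDouble k H).toLinearMap.lTensor (DrinfeldDouble k H))) key
  simpa [comul_inrHom, Finset.sum_mul_sum, Finset.sum_comm (s := (ℛ k h).index)] using this

/-- The case `x = p` of `R Δ(x) = Δ^{op}(x) R`: evaluating the factor `H^{*cop}` at `x ∈ H`
reduces it to the commutation relation of `p` and `x`. -/
lemma rMatrix_mul_comul_inl (p : DualCop k H) :
    (∑ i, inrHom k H (e i) ⊗ₜ[k] inlHom k H (dualFam e i)) * comul (inlHom k H p) =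
      TensorProduct.comm k _ _ (comul (inlHom k H p)) *
        ∑ i, inrHom k H (e i) ⊗ₜ[k] inlHom k H (dualFam e i) := by
  have key : ∑ i, ∑ l ∈ (ℛ k p).index,
      (inrHom k H (e i) * inlHom k H ((ℛ k p).left l)) ⊗ₜ[k] (dualFam e i * (ℛ k p).right l) =
      ∑ i, ∑ l ∈ (ℛ k p).index, (inlHom k H ((ℛ k p).right l) * inrHom k H (e i)) ⊗ₜ[k]
        ((ℛ k p).left l * dualFam e i) := by
    apply tmul_dual_ext
    intro x
    simp only [map_sum, evalR_tmul, DualCop.toDual_mul, toDual_dualFam, Finset.sum_smul]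
    have e1 : ∀ m, ∑ i, ∑ l ∈ (ℛ k x).index,
        (e.repr ((ℛ k x).left l) i * toDual k H ((ℛ k p).right m) ((ℛ k x).right l)) •
          (inrHom k H (e i) * inlHom k H ((ℛ k p).left m)) =
        ∑ l ∈ (ℛ k x).index, toDual k H ((ℛ k p).right m) ((ℛ k x).right l) •
          (inrHom k H ((ℛ k x).left l) * inlHom k H ((ℛ k p).left m)) := by
      intro m
      rw [Finset.sum_comm]
      refine Finset.sum_congr rfl fun l _ => ?_
      have := sum_repr_smul e (LinearMap.mulRight k (inlHom k H ((ℛ k p).left m)) ∘ₗ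
        (inrHom k H : H →ₐ[k] DrinfeldDouble k H).toLinearMap) ((ℛ k x).left l)
      simp_rw [mul_comm (e.repr _ _), mul_smul, ← Finset.smul_sum]
      exact congrArg _ this
    have e2 : ∀ m, ∑ i, ∑ l ∈ (ℛ k x).index,
        (toDual k H ((ℛ k p).left m) ((ℛ k x).left l) * e.repr ((ℛ k x).right l) i) •
          (inlHom k H ((ℛ k p).right m) * inrHom k H (e i)) =
        ∑ l ∈ (ℛ k x).index, toDual k H ((ℛ k p).left m) ((ℛ k x).left l) •
          (inlHom k H ((ℛ k p).right m) * inrHom k H ((ℛ k x).right l)) := by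
      intro m
      rw [Finset.sum_comm]
      refine Finset.sum_congr rfl fun l _ => ?_
      have := sum_repr_smul e (LinearMap.mulLeft k (inlHom k H ((ℛ k p).right m)) ∘ₗ
        (inrHom k H : H →ₐ[k] DrinfeldDouble k H).toLinearMap) ((ℛ k x).right l)
      simp_rw [mul_smul, ← Finset.smul_sum]
      exact congrArg _ this
    rw [Finset.sum_comm, Finset.sum_congr rfl fun m _ => e1 m, Finset.sum_comm,
      sum_inrHom_mul_inlHom p x]
    conv_rhs => rw [Finset.sum_comm, Finset.sum_congr rfl fun m _ => e2 m, Finset.sum_comm]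
  have := congrArg
    ((inlHom k H : DualCop k H →ₐ[k] DrinfeldDouble k H).toLinearMap.lTensor (DrinfeldDouble k H)) key
  simpa [comul_inlHom, Finset.sum_mul_sum, Finset.sum_comm (s := (ℛ k p).index)] using this

/-- The universal `R`-matrix `∑ eᵢ ⊗ eⁱ` of the Drinfeld double intertwines the comultiplication
and its opposite. -/
lemma rMatrix_mul_comul (x : DrinfeldDouble k H) :
    (∑ i, inrHom k H (e i) ⊗ₜ[k] inlHom k H (dualFam e i)) * comul x =
      TensorProduct.comm k _ _ (comul x) *
        ∑ i, inrHom k H (e i) ⊗ₜ[k] inlHom k H (dualFam e i) := by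
  have hx : x ∈ Submodule.span k
    (Set.range fun x : DualCop k H × H => inlHom k H x.1 * inrHom k H x.2) :=
    by rw [span_inlHom_mul_inrHom]; trivial
  have hc : ∀ s t : DrinfeldDouble k H ⊗[k] DrinfeldDouble k H,
      TensorProduct.comm k _ _ (s * t) = TensorProduct.comm k _ _ s * TensorProduct.comm k _ _ t :=
    map_mul (Algebra.TensorProduct.comm k (DrinfeldDouble k H) (DrinfeldDouble k H))
  induction hx using Submodule.span_induction with
  | mem x hx =>
    obtain ⟨⟨p, h⟩, rfl⟩ := hx
    rw [Bialgebra.comul_mul, ← mul_assoc, rMatrix_mul_comul_inl e, mul_assoc,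
      rMatrix_mul_comul_inr e, hc, mul_assoc]
  | zero => simp
  | add x y _ _ hx hy => simp only [map_add, mul_add, add_mul, hx, hy]
  | smul c x _ hx => simp only [map_smul, mul_smul_comm, smul_mul_assoc, hx]

/-- The Drinfeld element `u = ∑ S(eⁱ) eᵢ` of the double, written in terms of a basis `eᵢ` of `H`. -/
noncomputable def drinfeldElement : DrinfeldDouble k H :=
  ∑ i, inlHom k H (antipode k (dualFam e i)) * inrHom k H (e i)

/-- The element `∑ eⁱ S²(eᵢ)`, which is the inverse of the Drinfeld element. -/
noncomputable def drinfeldInv : DrinfeldDouble k H :=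
  ∑ i, inlHom k H (dualFam e i) * inrHom k H (antipode k (antipode k (e i)))

/-- The Drinfeld element implements `S²`. -/
lemma drinfeldElement_mul (x : DrinfeldDouble k H) :
    drinfeldElement e * x = antipode k (antipode k x) * drinfeldElement e := by
  have := sum_antipode_mul_mul (rMatrix_mul_comul e) x
  simpa only [antipode_bialgHom, drinfeldElement] using this

lemma drinfeldElement_mul_drinfeldInv : drinfeldElement e * drinfeldInv e = 1 := by
  have h1 : drinfeldElement e * drinfeldInv e = ∑ i, ∑ j,
      inlHom k H (antipode k (antipode k (dualFam e i)) * antipode k (dualFam e j)) *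
        inrHom k H (e j * antipode k (antipode k (e i))) := by
    rw [drinfeldInv, Finset.mul_sum]
    refine Finset.sum_congr rfl fun i _ => ?_
    rw [← mul_assoc, drinfeldElement_mul, drinfeldElement, Finset.mul_sum, Finset.sum_mul]
    simp [antipode_bialgHom, mul_assoc]
  have h2 := congrArg (LinearMap.mul' k (DrinfeldDouble k H) ∘
    TensorProduct.map (inlHom k H : DualCop k H →ₐ[k] DrinfeldDouble k H).toLinearMap
      (inrHom k H : H →ₐ[k] DrinfeldDouble k H).toLinearMap ∘ TensorProduct.comm k _ _)
        (sum_mul_antipode_dualFam e)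
  rw [h1]
  simpa [Algebra.TensorProduct.one_def] using h2

lemma drinfeldInv_mul_drinfeldElement : drinfeldInv e * drinfeldElement e = 1 := by
  have hs : Function.Surjective (LinearMap.mulLeft k (drinfeldElement e)) := fun x =>
    ⟨drinfeldInv e * x, by
      rw [LinearMap.mulLeft_apply, ← mul_assoc, drinfeldElement_mul_drinfeldInv, one_mul]⟩
  apply LinearMap.injective_iff_surjective.mpr hs
  simp only [LinearMap.mulLeft_apply]
  rw [← mul_assoc, drinfeldElement_mul_drinfeldInv, one_mul, mul_one]

lemma antipode_drinfeldInv : antipode k (drinfeldInv e) =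
    ∑ i, inrHom k H (antipode k (antipode k (e i))) * inlHom k H (dualFam e i) := by
  have h := congrArg (LinearMap.mul' k (DrinfeldDouble k H) ∘
    TensorProduct.map (inrHom k H : H →ₐ[k] DrinfeldDouble k H).toLinearMap
      (inlHom k H : DualCop k H →ₐ[k] DrinfeldDouble k H).toLinearMap)
        (sum_tmul_antipode_dualFam e (antipode k ∘ₗ antipode k ∘ₗ antipode k))
  simpa [drinfeldInv, antipode_mul_antidistrib, antipode_bialgHom] using h

lemma antipode_drinfeldInv_mul (x : DrinfeldDouble k H) :
    antipode k (drinfeldInv e) * x =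
      antipode k (antipode k x) * antipode k (drinfeldInv e) := by
  obtain ⟨x, rfl⟩ := antipode_surjective (k := k) x
  rw [← antipode_mul_antidistrib, ← antipode_mul_antidistrib]
  congr 1
  calc x * drinfeldInv e = drinfeldInv e * (drinfeldElement e * x) * drinfeldInv e := by
        rw [← mul_assoc, drinfeldInv_mul_drinfeldElement, one_mul]
    _ = _ := by
        rw [drinfeldElement_mul, mul_assoc, mul_assoc, drinfeldElement_mul_drinfeldInv, mul_one]

/-! ### Twisted power maps of the double -/

/-- The products `h q` of `h ∈ H` and `q ∈ H^{*cop}` are independent as well, since the antipode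
turns them into products in the order `q h`. -/
lemma exists_functional (p : DualCop k H) (h : H) : ∃ φ : Module.Dual k (DrinfeldDouble k H),
    ∀ x q, φ (inrHom k H x * inlHom k H q) = toDual k H p x * toDual k H q h := by
  let ψ : DualCop k H ⊗[k] H →ₗ[k] k := LinearMap.mul' k k ∘ₗ TensorProduct.map
    (Module.Dual.eval k H h ∘ₗ (toDual k H).toLinearMap ∘ₗ antipodeInv k (DualCop k H))
    (toDual k H p ∘ₗ antipodeInv k H)
  refine ⟨ψ ∘ₗ (CocycleTwist.of (doubleCocycle k H)).symm.toLinearMap ∘ₗ antipode k, fun x q => ?_⟩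
  simp only [LinearMap.comp_apply, antipode_mul_antidistrib, antipode_bialgHom,
    inlHom_mul_inrHom, LinearEquiv.coe_coe, LinearEquiv.symm_apply_apply]
  simp [ψ, mul_comm]

variable (k H) in
/-- The map `T ↦ ∑ (S(eⁱ) ⊗ S²(eⱼ)) Δ(T(eᵢ eʲ))` from the endomorphisms of the double to its tensor
square. -/
noncomputable def contraction (e : Module.Basis ι k H) :
    (DrinfeldDouble k H →ₗ[k] DrinfeldDouble k H) →ₗ[k]
      DrinfeldDouble k H ⊗[k] DrinfeldDouble k H :=
  ∑ p : ι × ι, LinearMap.mulLeft k (inlHom k H (antipode k (dualFam e p.1)) ⊗ₜ[k]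
    inrHom k H (antipode k (antipode k (e p.2)))) ∘ₗ comul ∘ₗ
      LinearMap.applyₗ (inrHom k H (e p.1) * inlHom k H (dualFam e p.2))

lemma contraction_apply (T : DrinfeldDouble k H →ₗ[k] DrinfeldDouble k H) :
    contraction k H e T = ∑ p : ι × ι, (inlHom k H (antipode k (dualFam e p.1)) ⊗ₜ[k]
      inrHom k H (antipode k (antipode k (e p.2)))) *
        comul (T (inrHom k H (e p.1) * inlHom k H (dualFam e p.2))) := by
  simp [contraction, LinearMap.sum_apply]

/-- The two sides have the same dimension, so surjectivity suffices; the endomorphisms of rank one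
produce all elements `(p ⊗ h) Δ(d)`, which span the tensor square of the double. -/
lemma contraction_injective : Function.Injective (contraction k H e) := by
  rw [LinearMap.injective_iff_surjective_of_finrank_eq_finrank
    (by rw [Module.finrank_linearMap, Module.finrank_tensorProduct]), ← LinearMap.range_eq_top]
  refine eq_top_of_mul_comul_mem (inlHom k H) (inrHom k H) span_inlHom_mul_inrHom _ ?_
  intro p q d
  obtain ⟨p, rfl⟩ := antipode_surjective (k := k) p
  obtain ⟨q, rfl⟩ := antipode_surjective (k := k) q
  obtain ⟨q, rfl⟩ := antipode_surjective (k := k) q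
  obtain ⟨φ, hφ⟩ := exists_functional p q
  refine ⟨φ.smulRight d, ?_⟩
  have h1 : ∑ i, toDual k H p (e i) • inlHom k H (antipode k (dualFam e i)) =
      inlHom k H (antipode k p) := by
    conv_rhs => rw [← sum_toDual_smul_dualFam e p]
    simp only [map_sum, map_smul]
  have h2 : ∑ j, e.repr q j • inrHom k H (antipode k (antipode k (e j))) =
      inrHom k H (antipode k (antipode k q)) := by
    conv_rhs => rw [← e.sum_repr q]
    simp only [map_sum, map_smul]
  rw [contraction_apply, ← h1, ← h2, TensorProduct.sum_tmul, Finset.sum_mul,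
    Fintype.sum_prod_type]
  refine Finset.sum_congr rfl fun i _ => ?_
  rw [TensorProduct.tmul_sum, Finset.sum_mul]
  refine Finset.sum_congr rfl fun j _ => ?_
  rw [LinearMap.smulRight_apply, hφ, toDual_dualFam, map_smul, TensorProduct.smul_tmul_smul,
    mul_smul_comm, smul_mul_assoc]

/-- The twisted power maps of the double correspond to the powers of `u ⊗ S(u⁻¹)`. -/
lemma contraction_twistedPower (n : ℕ) :
    contraction k H e (twistedPower k (DrinfeldDouble k H) n) =
      (drinfeldElement e ^ n) ⊗ₜ (antipode k (drinfeldInv e) ^ n) := by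
  have hX := (isAntiCanonical_basis e).map (inrHom k H)
    (inlHom k H : DualCop k H →ₐ[k] DrinfeldDouble k H)
  have hY := (isAntiCanonical_dualFam e).map (inlHom k H)
    (inrHom k H : H →ₐ[k] DrinfeldDouble k H)
  have hU := hX.sum_tmul_mul_comul hY (fun x => drinfeldElement_mul e x) (by
    have := congrArg (TensorProduct.map
      (inlHom k H : DualCop k H →ₐ[k] DrinfeldDouble k H).toLinearMap
      (inrHom k H : H →ₐ[k] DrinfeldDouble k H).toLinearMap ∘ TensorProduct.comm k _ _)
        (sum_mul_antipodeInv_dualFam e)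
    simpa [antipodeInv_bialgHom, Algebra.TensorProduct.one_def] using this)
  have hU' : ∑ p : ι × ι, (inlHom k H (antipode k (dualFam e p.1)) ⊗ₜ[k]
      inrHom k H (antipode k (antipode k (e p.2)))) *
        Bialgebra.comulAlgHom k _ (inrHom k H (e p.1) * inlHom k H (dualFam e p.2)) =
      drinfeldElement e ⊗ₜ antipode k (drinfeldInv e) := by
    rw [antipode_drinfeldInv]
    exact hU
  have hS : ∀ t : DrinfeldDouble k H ⊗[k] DrinfeldDouble k H,
      (drinfeldElement e ⊗ₜ antipode k (drinfeldInv e)) * t =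
        TensorProduct.map (antipode k ∘ₗ antipode k) (antipode k ∘ₗ antipode k) t *
          (drinfeldElement e ⊗ₜ antipode k (drinfeldInv e)) := by
    intro t
    induction t with
    | zero => simp
    | add s t hs ht => simp only [map_add, mul_add, add_mul, hs, ht]
    | tmul x y =>
      simp only [TensorProduct.map_tmul, Algebra.TensorProduct.tmul_mul_tmul,
        drinfeldElement_mul, antipode_drinfeldInv_mul, LinearMap.comp_apply]
  have := (hX.tmul hY).sum_twistedPower (Bialgebra.comulAlgHom k _) (fun x => by
    refine (congrArg (· * _) hU').trans ?_
    refine Eq.trans ?_ (congrArg (_ * ·) hU').symm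
    refine (hS _).trans ?_
    exact congrArg (· * _) (comul_antipode_antipode x).symm) n
  rw [contraction_apply]
  refine this.trans ?_
  rw [← Algebra.TensorProduct.tmul_pow]
  exact congrArg (· ^ n) hU'

/-- The twisted power maps of `H` correspond to the powers of `u`. -/
lemma drinfeldElement_pow (n : ℕ) : drinfeldElement e ^ n =
    ∑ i, inlHom k H (antipode k (dualFam e i)) * inrHom k H (twistedPower k H n (e i)) :=
  (((isAntiCanonical_basis e).map (BialgHom.id k H)
    (inlHom k H : DualCop k H →ₐ[k] DrinfeldDouble k H)).sum_twistedPower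
      (inrHom k H : H →ₐ[k] DrinfeldDouble k H) (fun x => by
        have := drinfeldElement_mul e (inrHom k H x)
        rw [antipode_bialgHom, antipode_bialgHom] at this
        exact this) n).symm

lemma inrHom_injective : Function.Injective (inrHom k H) := by
  intro x y h
  rw [inrHom_apply, inrHom_apply, (CocycleTwist.of (doubleCocycle k H)).injective.eq_iff] at h
  simpa using congrArg (projR k H) h

/-- The twisted power maps of `H` and of its double are trivial simultaneously. -/
theorem twistedPower_drinfeldDouble_eq_iff (n : ℕ) :
    twistedPower k (DrinfeldDouble k H) n = Algebra.linearMap k _ ∘ₗ counit ↔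
      twistedPower k H n = Algebra.linearMap k H ∘ₗ counit := by
  rw [← twistedPower_zero, ← twistedPower_zero]
  constructor <;> intro h
  · ext x
    apply inrHom_injective (k := k)
    rw [← twistedPower_bialgHom, ← twistedPower_bialgHom, h]
  · let e := Module.finBasis k H
    apply contraction_injective e
    have hu : drinfeldElement e ^ n = 1 := by
      rw [drinfeldElement_pow, h, ← drinfeldElement_pow, pow_zero]
    -- `u ^ n = 1` gives `S(u⁻¹) ^ n = 1`
    have hv : drinfeldInv e ^ n = 1 := by
      have hc : Commute (drinfeldElement e) (drinfeldInv e) :=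
        (drinfeldElement_mul_drinfeldInv e).trans (drinfeldInv_mul_drinfeldElement e).symm
      calc drinfeldInv e ^ n = drinfeldElement e ^ n * drinfeldInv e ^ n := by rw [hu, one_mul]
        _ = 1 := by rw [← hc.mul_pow, drinfeldElement_mul_drinfeldInv, one_pow]
    rw [contraction_twistedPower, contraction_twistedPower, hu, ← antipode_pow, hv,
      antipode_one,
      pow_zero, pow_zero]

end DrinfeldElement
end HopfExponent

theorem corollary3p4 (k : Type*) (H : Type*) [Field k] [Ring H] [HopfAlgebra k H]
    [FiniteDimensional k H] :
    HopfExponent.exponent k (HopfExponent.DrinfeldDouble k H) = HopfExponent.exponent k H := by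
  simp only [HopfExponent.exponent, HopfExponent.twistedPower_drinfeldDouble_eq_iff]
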